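/- Let $p$ be a prime, $a\ge 1$, $q=p^a$, let $\mathbb F_q$ be a field with $q$ elements, let $n\ge 0$ and $f\in\mathbb F_q[X_1,\dots,X_n]$. Let $R_0=W(\mathbb F_q)$ be the ring of Witt vectors, i.e. the ring of integers of the unramified extension of $\mathbb Q_p$ of degree $a$, and let $R=R_0[\pi]=R_0[x]/(x^{p-1}+p)$ be the ring obtained by adjoining an element $\pi$ with $\pi^{p-1}=-p$ (an integral domain), with its $p$-adic topology. Let $\tau$ be the automorphism of $R$ that is the Frobenius automorphism on $R_0$ and fixes $\pi$. Put $\theta(z)=\exp(\pi z-\pi z^p)$; its coefficients lie in $R$. Write $X=(X_0,\dots,X_n)$ and $X_0f=\sum_{j\in J}\bar a_jX^j$, where $J$ is the support of $X_0f$, and let $a_j\in R_0$ be the Teichmüller lifting of $\bar a_j$. Put $$F^{(a)}(X)=\prod_{j\in J}\prod_{s=0}^{a-1}\theta\big((a_jX^j)^{p^s}\big)\in R[[X]],$$ $$\psi_p\Big(\sum_rA_rX^r\Big)=\sum_r\tau^{-1}(A_{pr})X^r ,\qquad \alpha_a=\psi_p^a\circ F^{(a)},$$ so that $\alpha_a:R[[X]]\to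 R[[X]]$ is multiplication by $F^{(a)}$ followed by the $a$-th iterate of $\psi_p$. Let $d$ be the total degree of $f$ (with $d=0$ if $f=0$), let $\delta_1\subset\mathbb R^n$ be the convex hull of the support of $f$ and $\delta_2\subset\mathbb R^n$ the convex hull of $0,de_1,\dots,de_n$, where $e_1,\dots,e_n$ is the standard basis. Let $\delta$ be any convex polytope with integer vertices and $\delta_1\subseteq\delta\subseteq\delta_2$. Let $\Delta\subset\mathbb R^{n+1}$ be the convex hull of the origin and $\{1\}\times\delta$, let $C(\Delta)=\{cx : c\ge 0,\ x\in\Delta\}$, and let $L_\Delta\subset R[[X]]$ be the subring of the power series all of whose exponents lie in $C(\Delta)$. Then $\alpha_a$ maps $L_\Delta$ to itself. Let $M_a$ be the infinite matrix, with rows and columns indexed by $C(\Delta)\cap\mathbb Z_{\ge 0}^{n+1}$, whose entry at $(u,v)$ is the coefficient of $X^u$ in $\alpha_a(X^v)$. Each row of $M_a$ has only finitely many non-zero entries, so the powers $M_a^k$ are defined. **Theorem (Dwork's Trace Formula).** For $k\ge 1$ let $N_k^*$ be the number of zeros of $f$ in the torus $(\mathbb F_{q^k}^*)^n$. Then the sum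 of the diagonal entries of $M_a^k$ converges in $R$ to an element $\mathrm{Tr}(M_a^k)$, and $$(q^k-1)^{n+1}\,\mathrm{Tr}(M_a^k)=q^kN_k^*-(q^k-1)^n .$$ -/

import Mathlib

set_option linter.unusedSectionVars false

open Polynomial in
/-- The ring `R`: the ring `R₀ = W(𝔽_q)` of Witt vectors (the ring of integers of the unramified
extension of `ℚ_p` with residue field `𝔽_q`) with an element `π` adjoined, subject to
`π ^ (p - 1) = -p`. -/
noncomputable abbrev DworkR (p : ℕ) [Fact p.Prime] (𝔽 : Type*) [CommRing 𝔽] : Type _ :=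
  AdjoinRoot ((X : (WittVector p 𝔽)[X]) ^ (p - 1) + C ((p : ℕ) : WittVector p 𝔽))

namespace DworkR

section Ring

variable (p : ℕ) [Fact p.Prime] (𝔽 : Type*)

/-- The element `π` of `R`. -/
noncomputable def pi [CommRing 𝔽] : DworkR p 𝔽 := AdjoinRoot.root _

theorem pi_pow [CommRing 𝔽] : pi p 𝔽 ^ (p - 1) = -(p : DworkR p 𝔽) := by
  have h := AdjoinRoot.eval₂_root
    ((Polynomial.X : Polynomial (WittVector p 𝔽)) ^ (p - 1) + Polynomial.C (p : WittVector p 𝔽))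
  rw [Polynomial.eval₂_add, Polynomial.eval₂_pow, Polynomial.eval₂_X,
    Polynomial.eval₂_C, map_natCast] at h
  exact eq_neg_of_add_eq_zero_left h

/-- The topology of `R` is the `p`-adic one. -/
noncomputable instance instTopologicalSpace [CommRing 𝔽] : TopologicalSpace (DworkR p 𝔽) :=
  (Ideal.span {(p : DworkR p 𝔽)}).adicTopology

/-- The Teichmüller lifting of an element of `𝔽_q`, as an element of `R`. -/
noncomputable def teich [CommRing 𝔽] (c : 𝔽) : DworkR p 𝔽 :=
  AdjoinRoot.of _ (WittVector.teichmuller p c)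

variable [Field 𝔽] [Finite 𝔽] [CharP 𝔽 p]

/-- The automorphism `τ` of `R`: the Frobenius automorphism of the Witt vectors on `R₀`, and
`τ π = π`. -/
noncomputable def tau : DworkR p 𝔽 ≃+* DworkR p 𝔽 :=
  AdjoinRoot.mapRingEquiv (WittVector.frobeniusEquiv p 𝔽) _ _ (by
    simp only [Polynomial.map_add, Polynomial.map_pow, Polynomial.map_X, Polynomial.map_natCast,
      map_natCast]
    exact Associated.refl _)

theorem tau_pi : tau p 𝔽 (pi p 𝔽) = pi p 𝔽 := by
  simp [tau, pi, AdjoinRoot.map]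

theorem tau_of (x : WittVector p 𝔽) :
    tau p 𝔽 (AdjoinRoot.of _ x) = AdjoinRoot.of _ (WittVector.frobenius x) := by
  simp [tau, AdjoinRoot.map]

theorem natCast_ne_zero (m : ℕ) (hm : m ≠ 0) : (m : WittVector p 𝔽) ≠ 0 := by
  obtain ⟨v, u, hu, rfl⟩ := Nat.exists_eq_pow_mul_and_not_dvd hm p (Fact.out : p.Prime).ne_one
  push_cast
  refine mul_ne_zero (pow_ne_zero _ (WittVector.irreducible p).ne_zero) (fun h => hu ?_)
  have h2 := congrArg (WittVector.constantCoeff (p := p) (R := 𝔽)) h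
  rw [map_natCast, map_zero] at h2
  exact (CharP.cast_eq_zero_iff 𝔽 p u).1 h2

theorem natCast_isUnit (u : ℕ) (hu : ¬ p ∣ u) : IsUnit (u : WittVector p 𝔽) := by
  apply WittVector.isUnit_of_coeff_zero_ne_zero
  intro h
  have h2 : WittVector.constantCoeff (u : WittVector p 𝔽) = 0 := h
  rw [map_natCast] at h2
  exact hu ((CharP.cast_eq_zero_iff 𝔽 p u).1 h2)

theorem monic :
    ((Polynomial.X : Polynomial (WittVector p 𝔽)) ^ (p - 1)
      + Polynomial.C (p : WittVector p 𝔽)).Monic := by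
  apply Polynomial.monic_X_pow_add
  have := (Fact.out : p.Prime).two_le
  exact Polynomial.degree_C_le.trans_lt (by exact_mod_cast (by omega))

/-- The defining polynomial of `π` is an Eisenstein polynomial, so `R` is an integral domain. -/
instance instIsDomain : IsDomain (DworkR p 𝔽) := by
  apply AdjoinRoot.isDomain_of_prime
  apply Irreducible.prime
  have h2 := (Fact.out : p.Prime).two_le
  have hirr := WittVector.irreducible p (k := 𝔽)
  have hnd : ((Polynomial.X : Polynomial (WittVector p 𝔽)) ^ (p - 1)
      + Polynomial.C (p : WittVector p 𝔽)).natDegree = p - 1 := Polynomial.natDegree_X_pow_add_C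
  refine Polynomial.IsEisensteinAt.irreducible (𝓟 := Ideal.span {(p : WittVector p 𝔽)})
    ⟨?_, ?_, ?_⟩ ?_ (monic p 𝔽).isPrimitive (by rw [hnd]; omega)
  · rw [(monic p 𝔽).leadingCoeff, Ideal.mem_span_singleton]
    exact fun h => hirr.not_isUnit (isUnit_of_dvd_one h)
  · intro m hm
    rw [hnd] at hm
    rw [Polynomial.coeff_add, Polynomial.coeff_X_pow, if_neg hm.ne, zero_add,
      Polynomial.coeff_C]
    split_ifs
    · exact Ideal.mem_span_singleton_self _
    · exact zero_mem _
  · rw [Polynomial.coeff_add, Polynomial.coeff_X_pow, if_neg (by omega), zero_add,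
      Polynomial.coeff_C_zero, Ideal.span_singleton_pow, Ideal.mem_span_singleton]
    rintro ⟨c, hc⟩
    apply hirr.not_isUnit
    refine IsUnit.of_mul_eq_one c (mul_left_cancel₀ hirr.ne_zero ?_)
    linear_combination -hc
  · exact (Ideal.span_singleton_prime hirr.ne_zero).2 hirr.prime

instance instCharZero : CharZero (DworkR p 𝔽) := by
  apply charZero_of_inj_zero
  intro m hm
  by_contra h0
  have h2 := (Fact.out : p.Prime).two_le
  have hdeg : ((Polynomial.X : Polynomial (WittVector p 𝔽)) ^ (p - 1)
      + Polynomial.C (p : WittVector p 𝔽)).degree ≠ 0 := by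
    rw [Polynomial.degree_X_pow_add_C (by omega)]
    exact_mod_cast (by omega : p - 1 ≠ 0)
  have hinj := AdjoinRoot.of.injective_of_degree_ne_zero hdeg
  apply natCast_ne_zero p 𝔽 m h0
  apply hinj
  rw [map_natCast, map_zero]
  exact hm

/-- The field of fractions of `R`. -/
noncomputable abbrev K : Type _ := FractionRing (DworkR p 𝔽)

/-- The power series `exp (π z - π z ^ p)`. -/
noncomputable def thetaK : PowerSeries (K p 𝔽) :=
  (PowerSeries.exp (K p 𝔽)).subst
    (PowerSeries.C (algebraMap (DworkR p 𝔽) (K p 𝔽) (pi p 𝔽)) * PowerSeries.X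
      - PowerSeries.C (algebraMap (DworkR p 𝔽) (K p 𝔽) (pi p 𝔽)) * PowerSeries.X ^ p)

theorem factorial_dvd_pi_pow (m : ℕ) : (m.factorial : DworkR p 𝔽) ∣ pi p 𝔽 ^ m := by
  have hp : p.Prime := Fact.out
  obtain ⟨v, u, hu, huv⟩ := Nat.exists_eq_pow_mul_and_not_dvd m.factorial_ne_zero p hp.ne_one
  have hv : v = padicValNat p m.factorial := by
    have hu0 : u ≠ 0 := by rintro rfl; exact hu (dvd_zero _)
    rw [huv, padicValNat.mul (pow_ne_zero _ hp.ne_zero) hu0, padicValNat.prime_pow,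
      padicValNat.eq_zero_of_not_dvd hu, add_zero]
  have hle : (p - 1) * v ≤ m := by
    rw [hv, sub_one_mul_padicValNat_factorial]
    exact Nat.sub_le _ _
  have hunit : IsUnit (u : DworkR p 𝔽) := by
    have := (natCast_isUnit p 𝔽 u hu).map
      (AdjoinRoot.of ((Polynomial.X : Polynomial (WittVector p 𝔽)) ^ (p - 1)
        + Polynomial.C (p : WittVector p 𝔽)))
    rwa [map_natCast] at this
  rw [huv]
  push_cast
  rw [hunit.mul_right_dvd, ← Nat.sub_add_cancel hle, pow_add, pow_mul, pi_pow, neg_pow]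
  exact (Dvd.intro_left _ rfl).mul_left _

/-- The coefficients of `exp (π z - π z ^ p)` lie in `R`. -/
theorem exists_coeff_thetaK (r : ℕ) :
    ∃ c : DworkR p 𝔽, algebraMap (DworkR p 𝔽) (K p 𝔽) c = PowerSeries.coeff r (thetaK p 𝔽) := by
  have hp : p.Prime := Fact.out
  set φ := algebraMap (DworkR p 𝔽) (K p 𝔽) with hφ
  set b : PowerSeries (K p 𝔽) := PowerSeries.C (φ (pi p 𝔽)) * PowerSeries.X
      - PowerSeries.C (φ (pi p 𝔽)) * PowerSeries.X ^ p with hb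
  have hsub : PowerSeries.HasSubst b := by
    apply PowerSeries.HasSubst.of_constantCoeff_zero'
    simp [hb, hp.ne_zero]
  have hmap : b = PowerSeries.C (φ (pi p 𝔽)) *
      PowerSeries.map φ (PowerSeries.X - PowerSeries.X ^ p) := by
    simp [hb, mul_sub]
  change PowerSeries.coeff r (thetaK p 𝔽) ∈ φ.range
  unfold thetaK
  rw [PowerSeries.coeff_subst' hsub]
  refine finsum_induction (· ∈ φ.range) (zero_mem _) (fun _ _ => add_mem) (fun d => ?_)
  obtain ⟨t, ht⟩ := factorial_dvd_pi_pow p 𝔽 d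
  rw [hmap, mul_pow, ← map_pow, ← map_pow, ← map_pow, PowerSeries.coeff_C_mul,
    PowerSeries.coeff_map, PowerSeries.coeff_exp, ht, smul_eq_mul, map_mul, map_natCast φ,
    map_div₀, map_one, map_natCast (algebraMap ℚ (K p 𝔽))]
  have hd : (d.factorial : K p 𝔽) ≠ 0 := by exact_mod_cast d.factorial_ne_zero
  refine ⟨t * PowerSeries.coeff r ((PowerSeries.X - PowerSeries.X ^ p) ^ d), ?_⟩
  rw [map_mul]
  field_simp

/-- Dwork's splitting function `θ(z) = exp (π z - π z ^ p)`, as a power series over `R`. -/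
noncomputable def theta : PowerSeries (DworkR p 𝔽) :=
  PowerSeries.mk fun r => (exists_coeff_thetaK p 𝔽 r).choose

/-- This determines `theta`, since `R` embeds into its field of fractions. -/
theorem map_theta :
    PowerSeries.map (algebraMap (DworkR p 𝔽) (K p 𝔽)) (theta p 𝔽) = thetaK p 𝔽 := by
  ext r
  rw [PowerSeries.coeff_map, theta, PowerSeries.coeff_mk]
  exact (exists_coeff_thetaK p 𝔽 r).choose_spec

end Ring

end DworkR

namespace Dwork

section Polytope

variable {n : ℕ}

/-- The convex polytope `Δ` in `ℝ ^ (n + 1)`: the convex hull of the origin and of the image of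
`δ` under `x ↦ (1, x)`. -/
def polytope (δ : Set (Fin n → ℝ)) : Set (Fin (n + 1) → ℝ) :=
  convexHull ℝ (insert 0 ((fun x : Fin n → ℝ => (Fin.cons 1 x : Fin (n + 1) → ℝ)) '' δ))

/-- The cone `C(Δ)`: the union of the rays from the origin through the points of `Δ`. -/
def cone (δ : Set (Fin n → ℝ)) : Set (Fin (n + 1) → ℝ) :=
  {x | ∃ c : ℝ, 0 ≤ c ∧ ∃ y ∈ polytope δ, x = c • y}

theorem zero_mem_cone (δ : Set (Fin n → ℝ)) : (0 : Fin (n + 1) → ℝ) ∈ cone δ :=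
  ⟨0, le_rfl, 0, subset_convexHull ℝ _ (Set.mem_insert _ _), by simp⟩

theorem smul_mem_cone (δ : Set (Fin n → ℝ)) {c : ℝ} (hc : 0 ≤ c) {x : Fin (n + 1) → ℝ}
    (hx : x ∈ cone δ) : c • x ∈ cone δ := by
  obtain ⟨d, hd, y, hy, rfl⟩ := hx
  exact ⟨c * d, mul_nonneg hc hd, y, hy, by rw [mul_smul]⟩

theorem add_mem_cone (δ : Set (Fin n → ℝ)) {x y : Fin (n + 1) → ℝ}
    (hx : x ∈ cone δ) (hy : y ∈ cone δ) : x + y ∈ cone δ := by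
  obtain ⟨c, hc, x, hx, rfl⟩ := hx
  obtain ⟨d, hd, y, hy, rfl⟩ := hy
  rcases (add_nonneg hc hd).eq_or_lt with h | h
  · have h1 : c = 0 := by linarith
    have h2 : d = 0 := by linarith
    subst h1 h2
    simpa using zero_mem_cone δ
  · refine ⟨c + d, h.le, (c / (c + d)) • x + (d / (c + d)) • y,
      convex_convexHull ℝ _ hx hy (by positivity) (by positivity) (by field_simp), ?_⟩
    rw [smul_add, smul_smul, smul_smul, mul_div_cancel₀ _ h.ne', mul_div_cancel₀ _ h.ne']

/-- The lattice points of `C(Δ)` with non-negative coordinates, as exponents of monomials in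
`X_0, …, X_n`. -/
def latticePoints (δ : Set (Fin n → ℝ)) : AddSubmonoid (Fin (n + 1) →₀ ℕ) where
  carrier := {u | (fun i => (u i : ℝ)) ∈ cone δ}
  zero_mem' := by
    have h := zero_mem_cone δ
    simpa [Pi.zero_def] using h
  add_mem' := by
    intro u v hu hv
    have h := add_mem_cone δ hu hv
    simpa [Pi.add_def] using h

/-- The Newton polytope `δ₁` of `f`. -/
def newtonPolytope {𝔽 : Type*} [CommSemiring 𝔽] (f : MvPolynomial (Fin n) 𝔽) :
    Set (Fin n → ℝ) :=
  convexHull ℝ ((fun (r : Fin n →₀ ℕ) (i : Fin n) => (r i : ℝ)) '' (f.support : Set (Fin n →₀ ℕ)))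

/-- The simplex `δ₂` with vertices the origin and `d e_i`, where `d` is the total degree of
`f`. -/
def degreeSimplex {𝔽 : Type*} [CommSemiring 𝔽] (f : MvPolynomial (Fin n) 𝔽) :
    Set (Fin n → ℝ) :=
  convexHull ℝ (insert 0 (Set.range fun i : Fin n => Pi.single i (f.totalDegree : ℝ)))

/-- `δ` is a convex polytope with integer vertices lying between `δ₁` and `δ₂`. -/
structure IsAdmissible {𝔽 : Type*} [CommSemiring 𝔽] (f : MvPolynomial (Fin n) 𝔽)
    (δ : Set (Fin n → ℝ)) : Prop where
  integral : ∃ V : Set (Fin n → ℤ), V.Finite ∧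
    δ = convexHull ℝ ((fun (v : Fin n → ℤ) (i : Fin n) => (v i : ℝ)) '' V)
  newton_subset : newtonPolytope f ⊆ δ
  subset_simplex : δ ⊆ degreeSimplex f

end Polytope

section Operator

variable (p : ℕ) [Fact p.Prime] {𝔽 : Type*} [Field 𝔽] [Finite 𝔽] [CharP 𝔽 p] {n : ℕ}

/-- The polynomial `X_0 f`, in the variables `X_0, …, X_n`. -/
noncomputable def X0mul (f : MvPolynomial (Fin n) 𝔽) : MvPolynomial (Fin (n + 1)) 𝔽 :=
  MvPolynomial.X 0 * MvPolynomial.rename Fin.succ f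

/-- The power series `F^(a) = ∏_j ∏_{s < a} θ((a_j X^j)^(p^s))`, where `j` runs over the support
of `X_0 f` and `a_j` is the Teichmüller lifting of the coefficient of `X^j`. -/
noncomputable def Fpow (a : ℕ) (f : MvPolynomial (Fin n) 𝔽) :
    MvPowerSeries (Fin (n + 1)) (DworkR p 𝔽) :=
  ∏ j ∈ (X0mul f).support, ∏ s ∈ Finset.range a,
    (DworkR.theta p 𝔽).subst
      (MvPowerSeries.monomial j (DworkR.teich p 𝔽 ((X0mul f).coeff j)) ^ p ^ s)

/-- The map `ψ_p`, taking `∑ A_r X^r` to `∑ τ⁻¹(A_{p r}) X^r`. -/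
noncomputable def psi (A : MvPowerSeries (Fin (n + 1)) (DworkR p 𝔽)) :
    MvPowerSeries (Fin (n + 1)) (DworkR p 𝔽) :=
  fun r => (DworkR.tau p 𝔽).symm (MvPowerSeries.coeff (p • r) A)

/-- The map `α_a = ψ_p^a ∘ F^(a)` on `R[[X]]`. -/
noncomputable def alpha (a : ℕ) (f : MvPolynomial (Fin n) 𝔽)
    (A : MvPowerSeries (Fin (n + 1)) (DworkR p 𝔽)) :
    MvPowerSeries (Fin (n + 1)) (DworkR p 𝔽) :=
  (psi p)^[a] (Fpow p a f * A)

variable (𝔽) in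
/-- The subring `L_Δ` of `R[[X]]`: the power series all of whose exponents lie in `C(Δ)`. -/
noncomputable def LDelta (δ : Set (Fin n → ℝ)) :
    Subring (MvPowerSeries (Fin (n + 1)) (DworkR p 𝔽)) where
  carrier := {A | ∀ r, MvPowerSeries.coeff r A ≠ 0 → r ∈ latticePoints δ}
  zero_mem' := fun r h => absurd (map_zero _) h
  one_mem' := by
    classical
    intro r h
    rw [MvPowerSeries.coeff_one] at h
    have hr : r = 0 := by
      by_contra h0
      exact h (if_neg h0)
    exact hr ▸ zero_mem _
  add_mem' := by
    intro A B hA hB r h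
    by_cases h1 : MvPowerSeries.coeff r A = 0
    · refine hB r (fun h2 => h ?_)
      rw [map_add, h1, h2, add_zero]
    · exact hA r h1
  neg_mem' := by
    intro A hA r h
    exact hA r (fun h2 => h (by rw [map_neg, h2, neg_zero]))
  mul_mem' := by
    classical
    intro A B hA hB r h
    rw [MvPowerSeries.coeff_mul] at h
    obtain ⟨x, hx, hne⟩ := Finset.exists_ne_zero_of_sum_ne_zero h
    rw [← Finset.HasAntidiagonal.mem_antidiagonal.1 hx]
    exact add_mem (hA _ (left_ne_zero_of_mul hne)) (hB _ (right_ne_zero_of_mul hne))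

theorem monomial_mem_LDelta (δ : Set (Fin n → ℝ)) {u : Fin (n + 1) →₀ ℕ}
    (hu : u ∈ latticePoints δ) (c : DworkR p 𝔽) :
    MvPowerSeries.monomial u c ∈ LDelta p 𝔽 δ := by
  classical
  intro r h
  rw [MvPowerSeries.coeff_monomial] at h
  have hr : r = u := by
    by_contra h0
    exact h (if_neg h0)
  exact hr ▸ hu

theorem mem_latticePoints_of_mem_support {f : MvPolynomial (Fin n) 𝔽} {δ : Set (Fin n → ℝ)}
    (hδ : newtonPolytope f ⊆ δ) {j : Fin (n + 1) →₀ ℕ} (hj : j ∈ (X0mul f).support) :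
    j ∈ latticePoints δ := by
  classical
  rw [X0mul, MvPolynomial.support_X_mul, Finset.mem_map] at hj
  obtain ⟨i, hi, rfl⟩ := hj
  rw [MvPolynomial.support_rename_of_injective (Fin.succ_injective n), Finset.mem_image] at hi
  obtain ⟨r, hr, rfl⟩ := hi
  refine ⟨1, zero_le_one, _, subset_convexHull ℝ _ (Set.mem_insert_of_mem _ ⟨_,
    hδ (subset_convexHull ℝ _ ⟨r, hr, rfl⟩), rfl⟩), ?_⟩
  rw [one_smul]
  ext l
  refine Fin.cases ?_ (fun l => ?_) l
  · have : Finsupp.mapDomain Fin.succ r (0 : Fin (n + 1)) = 0 :=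
      Finsupp.mapDomain_of_notMem_range _ _ (by rintro ⟨i, hi⟩; exact Fin.succ_ne_zero i hi)
    simp [this]
  · simp [Finsupp.mapDomain_apply (Fin.succ_injective n)]

theorem subst_monomial_mem_LDelta {δ : Set (Fin n → ℝ)} {j : Fin (n + 1) →₀ ℕ}
    (hj : j ∈ latticePoints δ) (h0 : j ≠ 0) (c : DworkR p 𝔽) (m : ℕ) (hm : m ≠ 0)
    (g : PowerSeries (DworkR p 𝔽)) :
    g.subst (MvPowerSeries.monomial j c ^ m) ∈ LDelta p 𝔽 δ := by
  intro r hr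
  have hsub : PowerSeries.HasSubst (MvPowerSeries.monomial j c ^ m) := by
    rw [MvPowerSeries.monomial_pow]
    exact PowerSeries.HasSubst.monomial (smul_ne_zero hm h0) _
  rw [PowerSeries.coeff_subst hsub] at hr
  by_contra hnot
  apply hr
  refine finsum_eq_zero_of_forall_eq_zero (fun d => ?_)
  by_contra hd
  exact hnot (pow_mem (pow_mem (monomial_mem_LDelta p δ hj c) m) d r (right_ne_zero_of_smul hd))

theorem Fpow_mem_LDelta (a : ℕ) {f : MvPolynomial (Fin n) 𝔽} {δ : Set (Fin n → ℝ)}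
    (hδ : newtonPolytope f ⊆ δ) : Fpow p a f ∈ LDelta p 𝔽 δ := by
  classical
  refine prod_mem fun j hj => prod_mem fun s _ => ?_
  refine subst_monomial_mem_LDelta p (mem_latticePoints_of_mem_support hδ hj) ?_ _ _
    (pow_ne_zero _ (Fact.out : p.Prime).ne_zero) _
  rw [X0mul, MvPolynomial.support_X_mul, Finset.mem_map] at hj
  obtain ⟨i, _, rfl⟩ := hj
  intro h
  have := DFunLike.congr_fun h 0
  simp at this

theorem psi_mem_LDelta {δ : Set (Fin n → ℝ)} {A : MvPowerSeries (Fin (n + 1)) (DworkR p 𝔽)}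
    (hA : A ∈ LDelta p 𝔽 δ) : psi p A ∈ LDelta p 𝔽 δ := by
  intro r hr
  have hp : (0 : ℝ) < p := by exact_mod_cast (Fact.out : p.Prime).pos
  have h1 : p • r ∈ latticePoints δ := by
    refine hA _ (fun h => hr ?_)
    change (DworkR.tau p 𝔽).symm (MvPowerSeries.coeff (p • r) A) = 0
    rw [h, map_zero]
  have h2 := smul_mem_cone δ (inv_nonneg.2 hp.le) h1
  have h3 : ((p : ℝ)⁻¹ • fun i => (((p • r) i : ℕ) : ℝ)) = fun i => (r i : ℝ) := by
    ext i
    simp [hp.ne']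
  rw [h3] at h2
  exact h2

theorem alpha_mem_LDelta (a : ℕ) {f : MvPolynomial (Fin n) 𝔽} {δ : Set (Fin n → ℝ)}
    (hδ : newtonPolytope f ⊆ δ) {A : MvPowerSeries (Fin (n + 1)) (DworkR p 𝔽)}
    (hA : A ∈ LDelta p 𝔽 δ) : alpha p a f A ∈ LDelta p 𝔽 δ := by
  have h : ∀ (b : ℕ) (B : MvPowerSeries (Fin (n + 1)) (DworkR p 𝔽)),
      B ∈ LDelta p 𝔽 δ → (psi p)^[b] B ∈ LDelta p 𝔽 δ := by
    intro b
    induction b with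
    | zero => exact fun B hB => hB
    | succ b ih => exact fun B hB => ih _ (psi_mem_LDelta p hB)
  exact h a _ (mul_mem (Fpow_mem_LDelta p a hδ) hA)

/-- The restriction of `α_a` to `L_Δ`. -/
noncomputable def alphaRestrict (a : ℕ) (f : MvPolynomial (Fin n) 𝔽) {δ : Set (Fin n → ℝ)}
    (hδ : IsAdmissible f δ) (A : LDelta p 𝔽 δ) : LDelta p 𝔽 δ :=
  ⟨alpha p a f A, alpha_mem_LDelta p a hδ.newton_subset A.2⟩

/-- The matrix of a map from `L_Δ` to itself in the formal basis of monomials: its column `v`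
holds the coefficients of the image of `X^v`. -/
noncomputable def monomialMatrix {δ : Set (Fin n → ℝ)} (φ : LDelta p 𝔽 δ → LDelta p 𝔽 δ) :
    Matrix (latticePoints δ) (latticePoints δ) (DworkR p 𝔽) :=
  fun u v => MvPowerSeries.coeff (u : Fin (n + 1) →₀ ℕ)
    (φ ⟨MvPowerSeries.monomial (v : Fin (n + 1) →₀ ℕ) 1, monomial_mem_LDelta p δ v.2 1⟩).1

/-- The infinite matrix `M_a` of `α_a` on `L_Δ`. -/
noncomputable def Ma (a : ℕ) (f : MvPolynomial (Fin n) 𝔽) {δ : Set (Fin n → ℝ)}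
    (hδ : IsAdmissible f δ) : Matrix (latticePoints δ) (latticePoints δ) (DworkR p 𝔽) :=
  monomialMatrix p (alphaRestrict p a f hδ)

theorem psi_iterate_apply (b : ℕ) (A : MvPowerSeries (Fin (n + 1)) (DworkR p 𝔽))
    (r : Fin (n + 1) →₀ ℕ) :
    MvPowerSeries.coeff r ((psi p)^[b] A) =
      (DworkR.tau p 𝔽).symm^[b] (MvPowerSeries.coeff (p ^ b • r) A) := by
  induction b generalizing A r with
  | zero => simp
  | succ b ih =>
    rw [Function.iterate_succ_apply, ih, Function.iterate_succ_apply, pow_succ', mul_smul]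
    rfl

/-- Every row of `M_a` has only finitely many non-zero entries. -/
theorem Ma_row_finite (a : ℕ) (f : MvPolynomial (Fin n) 𝔽) {δ : Set (Fin n → ℝ)}
    (hδ : IsAdmissible f δ) (u : latticePoints δ) : {v | Ma p a f hδ u v ≠ 0}.Finite := by
  refine Set.Finite.subset ((Set.finite_Iic
    (p ^ a • (u : Fin (n + 1) →₀ ℕ))).preimage Subtype.val_injective.injOn) (fun v hv => ?_)
  by_contra hle
  apply hv
  change MvPowerSeries.coeff (u : Fin (n + 1) →₀ ℕ) ((psi p)^[a] (Fpow p a f *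
    MvPowerSeries.monomial (v : Fin (n + 1) →₀ ℕ) 1)) = 0
  have hle2 : ¬ (v : Fin (n + 1) →₀ ℕ) ≤ p ^ a • (u : Fin (n + 1) →₀ ℕ) := hle
  rw [psi_iterate_apply, MvPowerSeries.coeff_mul_monomial, if_neg hle2]
  exact Function.iterate_fixed (map_zero _) a

end Operator

/-- The powers of an infinite matrix with finitely many non-zero entries in each row, by
`A ^ 0 = 1` and `A ^ (k + 1) = A * A ^ k`; the sums that give the entries are finite. -/
noncomputable def matPow {ι R : Type*} [DecidableEq ι] [Semiring R] (A : Matrix ι ι R) :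
    ℕ → Matrix ι ι R
  | 0 => 1
  | k + 1 => fun u v => ∑ᶠ w, A u w * matPow A k w v

/-- The infinite matrix `A` has trace `t`: the sum of its diagonal entries converges to `t`. -/
def HasTrace {ι R : Type*} [AddCommMonoid R] [TopologicalSpace R] (A : Matrix ι ι R) (t : R) :
    Prop :=
  HasSum (fun u => A u u) t

/-- The number of zeros of `f` in the torus `(Eˣ)^n`. -/
noncomputable def torusZeros {𝔽 : Type*} [Field 𝔽] {n : ℕ} (f : MvPolynomial (Fin n) 𝔽)
    (E : Type*) [Field E] [Algebra 𝔽 E] : ℕ :=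
  Nat.card {x : Fin n → Eˣ // MvPolynomial.aeval (fun i => (x i : E)) f = 0}

end Dwork

/-! Write `Q = q^k` and let `E` have `Q` elements. The substitution rule ψ(A(X^m)B) = A·ψ(B) and the
factorisation of `F^(b+a)` (`Fpow_add`) make `M_a^k` the matrix of the operator built from `F^(ak)`.
Its diagonal entry at `u` is therefore the coefficient of `F^(ak)` at `(Q-1)u` (`matPow_Ma_diag`).
Summing `F^(ak)` over all Teichmüller points of the torus `(Eˣ)^(n+1)` keeps exactly the exponents
divisible by `Q-1`, so the sum is `(Q-1)^(n+1)` times the trace.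

The same sum counts zeros. The product Θ(t) of θ over the powers `teich t ^ p^i`, `i < ak`, is an
additive character of `E` (`thetaProd_add`), and `F^(ak)` at the point over `x` equals Θ(x₀ f(x)).
Since Θ(0) = 1 and the sum of Θ over `E` is zero, summing over x₀ ≠ 0 gives `Q-1` if f(x) = 0 and
`-1` otherwise. The total is `Q N - (Q-1)^n`.

Two analytic facts are needed. The coefficients of θ tend to zero (`pow_dvd_coeff_theta`), although
those of exp(πz) need not; this comes from comparing θ with the integral Artin-Hasse exponential.
And Θ is additive: formally log θ(x) = π(x - x^p), and the corrections telescope along the Frobenius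
orbit of a Teichmüller point.

Infinite sums are avoided by working over `R_E` modulo a power of π, where θ and `F^(ak)` become
polynomials. There π is nilpotent, so the character sum vanishes only after multiplication by π; one
extra power of π in the modulus pays for this. The congruences descend from `R_E` to `R` because
base change reflects divisibility by powers of π. -/

namespace PowerSeries

/-! ### Logarithmic derivatives of power series -/

section LogDerivative

variable {R : Type*} [CommRing R]

theorem coeff_succ_of_derivative_eq_mul {L A : PowerSeries R} (h : d⁄dX R A = L * A) (m : ℕ) :
    (m + 1 : R) * coeff (m + 1) A =
      ∑ x ∈ Finset.HasAntidiagonal.antidiagonal m, coeff x.1 L * coeff x.2 A := by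
  rw [← coeff_mul, ← h, coeff_derivative, mul_comm]

/-- A linear differential equation `A' = L * A` has at most one solution with given constant
coefficient. -/
theorem eq_of_derivative_eq_mul [IsDomain R] [CharZero R] {L A B : PowerSeries R}
    (hA : d⁄dX R A = L * A) (hB : d⁄dX R B = L * B)
    (h0 : constantCoeff A = constantCoeff B) : A = B := by
  ext m
  induction m using Nat.strong_induction_on with
  | _ m ih =>
    cases m with
    | zero => simpa using h0
    | succ m =>
      have hm : (m + 1 : R) ≠ 0 := by exact_mod_cast m.succ_ne_zero
      refine mul_left_cancel₀ hm ?_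
      rw [coeff_succ_of_derivative_eq_mul hA, coeff_succ_of_derivative_eq_mul hB]
      refine Finset.sum_congr rfl fun x hx => ?_
      rw [ih x.2 (by have := Finset.HasAntidiagonal.mem_antidiagonal.1 hx; omega)]

theorem derivative_map {S : Type*} [CommRing S] (φ : R →+* S) (A : PowerSeries R) :
    d⁄dX S (map φ A) = map φ (d⁄dX R A) := by
  ext m
  simp [coeff_derivative]

theorem derivative_rescale (c : R) (A : PowerSeries R) :
    d⁄dX R (rescale c A) = C c * rescale c (d⁄dX R A) := by
  ext m
  simp only [coeff_derivative, coeff_rescale, coeff_C_mul]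
  ring

theorem derivative_expand (k : ℕ) (hk : k ≠ 0) (A : PowerSeries R) :
    d⁄dX R (expand k hk A) = ((k : PowerSeries R) * X ^ (k - 1)) * expand k hk (d⁄dX R A) := by
  rw [expand_apply, expand_apply, derivative_subst (HasSubst.X_pow hk), derivative_pow,
    derivative_X, mul_one, mul_comm]

theorem logDerivative_mul {L M A B : PowerSeries R} (hA : d⁄dX R A = L * A)
    (hB : d⁄dX R B = M * B) : d⁄dX R (A * B) = (L + M) * (A * B) := by
  rw [Derivation.leibniz, hA, hB, smul_eq_mul, smul_eq_mul]
  ring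

theorem logDerivative_pow {L A : PowerSeries R} (hA : d⁄dX R A = L * A) (k : ℕ) :
    d⁄dX R (A ^ k) = (k * L) * A ^ k := by
  cases k with
  | zero => simp
  | succ k =>
    rw [derivative_pow, hA, Nat.add_sub_cancel]
    ring

theorem logDerivative_rescale {L A : PowerSeries R} (hA : d⁄dX R A = L * A) (c : R) :
    d⁄dX R (rescale c A) = (C c * rescale c L) * rescale c A := by
  rw [derivative_rescale, hA, map_mul, mul_assoc]

theorem logDerivative_expand {L A : PowerSeries R} (hA : d⁄dX R A = L * A) (k : ℕ)
    (hk : k ≠ 0) : d⁄dX R (expand k hk A) =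
      ((k : PowerSeries R) * X ^ (k - 1) * expand k hk L) * expand k hk A := by
  rw [derivative_expand, hA, map_mul, mul_assoc, mul_assoc, mul_assoc]

theorem constantCoeff_rescale (c : R) (A : PowerSeries R) :
    constantCoeff (rescale c A) = constantCoeff A := by
  rw [← coeff_zero_eq_constantCoeff_apply, coeff_rescale, pow_zero, one_mul,
    coeff_zero_eq_constantCoeff_apply]

theorem constantCoeff_subst_of_constantCoeff_eq_zero (A : PowerSeries R) {g : PowerSeries R}
    (hg : constantCoeff g = 0) : constantCoeff (A.subst g) = constantCoeff A := by
  rw [← coeff_zero_eq_constantCoeff_apply, coeff_subst' (HasSubst.of_constantCoeff_zero' hg),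
    finsum_eq_single _ 0]
  · simp
  · intro m hm
    simp [hg, hm]

theorem rescale_C (c r : R) : rescale c (C r) = C r := by
  ext m
  rw [coeff_rescale, coeff_C]
  split_ifs with h
  · simp [h]
  · simp

theorem rescale_expand (c : R) (k : ℕ) (hk : k ≠ 0) (A : PowerSeries R) :
    rescale c (expand k hk A) = expand k hk (rescale (c ^ k) A) := by
  ext m
  rw [coeff_rescale, coeff_expand, coeff_expand]
  split_ifs with h
  · obtain ⟨j, rfl⟩ := h
    rw [Nat.mul_div_cancel_left _ (Nat.pos_of_ne_zero hk), coeff_rescale, pow_mul]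
  · simp

end LogDerivative

end PowerSeries

namespace DworkR

open PowerSeries

/-! ### The exponential exp(πz) and the addition formula for θ -/

section Exp

variable (p : ℕ) [Fact p.Prime] (𝔽 : Type*) [Field 𝔽] [Finite 𝔽] [CharP 𝔽 p]

/-- The power series `exp (π z)`, which has coefficients in `R`. -/
noncomputable def expPi : PowerSeries (DworkR p 𝔽) :=
  mk fun m => (factorial_dvd_pi_pow p 𝔽 m).choose

theorem factorial_mul_coeff_expPi (m : ℕ) :
    (m.factorial : DworkR p 𝔽) * coeff m (expPi p 𝔽) = pi p 𝔽 ^ m := by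
  rw [expPi, coeff_mk]
  exact (factorial_dvd_pi_pow p 𝔽 m).choose_spec.symm

theorem coeff_succ_expPi (m : ℕ) :
    (m + 1 : DworkR p 𝔽) * coeff (m + 1) (expPi p 𝔽) = pi p 𝔽 * coeff m (expPi p 𝔽) := by
  have hm : (m.factorial : DworkR p 𝔽) ≠ 0 := by exact_mod_cast m.factorial_ne_zero
  refine mul_left_cancel₀ hm ?_
  have h1 := factorial_mul_coeff_expPi p 𝔽 (m + 1)
  have h2 := factorial_mul_coeff_expPi p 𝔽 m
  rw [Nat.factorial_succ] at h1
  push_cast at h1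
  linear_combination h1 - pi p 𝔽 * h2

theorem derivative_expPi : d⁄dX _ (expPi p 𝔽) = C (pi p 𝔽) * expPi p 𝔽 := by
  ext m
  rw [coeff_derivative, coeff_C_mul, ← coeff_succ_expPi, mul_comm]

theorem constantCoeff_expPi : constantCoeff (expPi p 𝔽) = 1 := by
  simpa using factorial_mul_coeff_expPi p 𝔽 0

theorem logDerivative_theta : d⁄dX _ (theta p 𝔽) =
    (C (pi p 𝔽) - C ((p : DworkR p 𝔽) * pi p 𝔽) * X ^ (p - 1)) * theta p 𝔽 := by
  have hp : p ≠ 0 := (Fact.out : p.Prime).ne_zero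
  apply map_injective (algebraMap (DworkR p 𝔽) (K p 𝔽)) (IsFractionRing.injective _ _)
  have hsub : HasSubst (C (algebraMap (DworkR p 𝔽) (K p 𝔽) (pi p 𝔽)) * X
      - C (algebraMap (DworkR p 𝔽) (K p 𝔽) (pi p 𝔽)) * X ^ p : PowerSeries (K p 𝔽)) := by
    apply HasSubst.of_constantCoeff_zero'
    simp [hp]
  rw [← derivative_map, map_mul, map_theta, thetaK, derivative_subst hsub, derivative_exp,
    mul_comm]
  congr 1
  simp only [map_sub, map_mul, Derivation.leibniz, derivative_X, derivative_pow, derivative_C,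
    map_C, map_X, map_pow, map_natCast, smul_eq_mul]
  ring

theorem constantCoeff_theta : constantCoeff (theta p 𝔽) = 1 := by
  have hp : p ≠ 0 := (Fact.out : p.Prime).ne_zero
  apply IsFractionRing.injective (DworkR p 𝔽) (K p 𝔽)
  have h := congrArg constantCoeff (map_theta p 𝔽)
  have h' : algebraMap (DworkR p 𝔽) (K p 𝔽) (constantCoeff (theta p 𝔽)) =
      constantCoeff (thetaK p 𝔽) := h
  rw [h', thetaK, constantCoeff_subst_of_constantCoeff_eq_zero _ (by simp [hp]),
    constantCoeff_exp, map_one]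

variable {p 𝔽}

theorem rescale_add_expPi (x y : DworkR p 𝔽) :
    rescale (x + y) (expPi p 𝔽) = rescale x (expPi p 𝔽) * rescale y (expPi p 𝔽) := by
  have h := derivative_expPi p 𝔽
  refine eq_of_derivative_eq_mul (logDerivative_rescale h _) ?_ ?_
  · rw [logDerivative_mul (logDerivative_rescale h x) (logDerivative_rescale h y)]
    simp only [rescale_C, map_add]
    ring
  · simp [constantCoeff_rescale, constantCoeff_expPi]

theorem logDerivative_rescale_theta (x : DworkR p 𝔽) : d⁄dX _ (rescale x (theta p 𝔽)) =
    (C (x * pi p 𝔽) - C ((p : DworkR p 𝔽) * pi p 𝔽 * x ^ p) * X ^ (p - 1)) *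
      rescale x (theta p 𝔽) := by
  rw [logDerivative_rescale (logDerivative_theta p 𝔽)]
  congr 1
  rw [map_sub, map_mul, map_pow, rescale_C, rescale_C, rescale_X, mul_sub, ← map_mul,
    mul_pow, ← map_pow, mul_left_comm, ← mul_assoc, ← mul_assoc, ← map_mul, ← map_mul, mul_comm x,
    mul_assoc (_ * _), ← pow_succ', Nat.sub_add_cancel (Fact.out : p.Prime).one_le]

/-- The term πz of log θ is additive in the scaling factor, so the whole defect comes from -πz^p: it
is π(x^p + y^p - (x+y)^p)z^p = πpc z^p. The factor `p` is what lets the correction be evaluated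
later, unlike exp(πz) itself. -/
theorem rescale_add_theta {x y c : DworkR p 𝔽} (hc : x ^ p + y ^ p - (x + y) ^ p = p * c) :
    rescale (x + y) (theta p 𝔽) = rescale x (theta p 𝔽) * rescale y (theta p 𝔽) *
      expand p (Fact.out : p.Prime).ne_zero (rescale (p * c) (expPi p 𝔽)) := by
  refine eq_of_derivative_eq_mul (logDerivative_rescale_theta _) ?_ ?_
  · rw [logDerivative_mul (logDerivative_mul (logDerivative_rescale_theta x)
      (logDerivative_rescale_theta y)) (logDerivative_expand
        (logDerivative_rescale (derivative_expPi p 𝔽) _) p (Fact.out : p.Prime).ne_zero)]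
    congr 1
    have hc' := congrArg (C : DworkR p 𝔽 →+* _) hc
    simp only [rescale_C, map_sub, map_add, map_pow, map_mul, map_natCast, expand_C] at hc' ⊢
    linear_combination -(p : PowerSeries (DworkR p 𝔽)) * C (pi p 𝔽) * X ^ (p - 1) * hc'
  · simp [constantCoeff_rescale, constantCoeff_expPi, constantCoeff_theta]

theorem theta_eq : theta p 𝔽 = expPi p 𝔽 *
    expand p (Fact.out : p.Prime).ne_zero (rescale (-1) (expPi p 𝔽)) := by
  have h := derivative_expPi p 𝔽
  refine eq_of_derivative_eq_mul (logDerivative_theta p 𝔽) ?_ ?_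
  · rw [logDerivative_mul h (logDerivative_expand (logDerivative_rescale h _) p
      (Fact.out : p.Prime).ne_zero)]
    congr 1
    simp only [rescale_C, map_mul, expand_C, map_neg, map_one, map_natCast]
    ring
  · simp [constantCoeff_rescale, constantCoeff_expPi, constantCoeff_theta]

theorem rescale_theta_eq (c : DworkR p 𝔽) : rescale c (theta p 𝔽) = rescale c (expPi p 𝔽) *
    expand p (Fact.out : p.Prime).ne_zero (rescale (-c ^ p) (expPi p 𝔽)) := by
  rw [theta_eq, map_mul, rescale_expand, rescale_rescale]
  simp

end Exp

end DworkR

/-- Legendre: (p-1)·v_p(m!) is m minus the base-p digit sum, which is at least 1 for m ≠ 0. The gain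
of 1 over the bound `m` yields a spare factor π in exp(πz) and a spare `p` in exp(pz). -/
theorem Nat.Prime.exists_factorial_eq_pow_mul {p : ℕ} (hp : p.Prime) {m : ℕ} (hm : m ≠ 0) :
    ∃ v u : ℕ, m.factorial = p ^ v * u ∧ ¬ p ∣ u ∧ (p - 1) * v ≤ m - 1 := by
  have : Fact p.Prime := ⟨hp⟩
  obtain ⟨v, u, hu, huv⟩ := Nat.exists_eq_pow_mul_and_not_dvd m.factorial_ne_zero p hp.ne_one
  refine ⟨v, u, huv, hu, ?_⟩
  have hu0 : u ≠ 0 := by rintro rfl; exact hu (dvd_zero _)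
  have hv : v = padicValNat p m.factorial := by
    rw [huv, padicValNat.mul (pow_ne_zero _ hp.ne_zero) hu0, padicValNat.prime_pow,
      padicValNat.eq_zero_of_not_dvd hu, add_zero]
  rw [hv]
  have := sub_one_mul_padicValNat_factorial_lt_of_ne_zero p hm
  omega

theorem PadicInt.factorial_dvd_pow (p : ℕ) [Fact p.Prime] {m : ℕ} (hm : m ≠ 0) :
    (m.factorial : ℤ_[p]) ∣ (p : ℤ_[p]) ^ (m - 1) := by
  have hp : p.Prime := Fact.out
  obtain ⟨v, u, huv, hu, hv⟩ := hp.exists_factorial_eq_pow_mul hm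
  have hunit : IsUnit (u : ℤ_[p]) := by
    rw [PadicInt.isUnit_iff, PadicInt.norm_natCast_eq_one_iff]
    exact (hp.coprime_iff_not_dvd.2 hu)
  rw [huv]
  push_cast
  rw [hunit.mul_right_dvd]
  refine pow_dvd_pow _ (le_trans ?_ hv)
  exact Nat.le_mul_of_pos_left _ (Nat.sub_pos_of_lt hp.one_lt)

/-! ### Integrality of the Artin-Hasse exponential -/

namespace PowerSeries

open Classical in
/-- The power series `∑ X ^ (p ^ r - 1)`. -/
noncomputable def primePowerSeries (p : ℕ) (R : Type*) [CommRing R] : PowerSeries R :=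
  mk fun m => if ∃ r, m + 1 = p ^ r then 1 else 0

theorem map_primePowerSeries (p : ℕ) {R S : Type*} [CommRing R] [CommRing S] (φ : R →+* S) :
    map φ (primePowerSeries p R) = primePowerSeries p S := by
  ext m
  simp only [primePowerSeries, coeff_map, coeff_mk]
  split_ifs <;> simp

/-- Shifting r to r + 1 in the sum. This is the logarithmic derivative of the functional equation in
`artinHasseRat_pow`. -/
theorem primePowerSeries_eq (p : ℕ) (hp : 1 < p) (R : Type*) [CommRing R] :
    primePowerSeries p R =
      1 + X ^ (p - 1) * expand p (by omega) (primePowerSeries p R) := by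
  ext m
  rw [map_add, coeff_one, coeff_X_pow_mul', coeff_expand]
  simp only [primePowerSeries, coeff_mk]
  rcases Nat.eq_zero_or_pos m with rfl | hm
  · rw [if_pos ⟨0, by simp⟩, if_pos rfl, if_neg (by omega), add_zero]
  · rw [if_neg hm.ne', zero_add]
    by_cases h : ∃ r, m + 1 = p ^ r
    · obtain ⟨r, hr⟩ := h
      cases r with
      | zero => simp at hr; omega
      | succ r =>
        have h1 : p ^ r ≠ 0 := pow_ne_zero _ (by omega)
        obtain ⟨j, hj⟩ := Nat.exists_eq_succ_of_ne_zero h1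
        have hm' : m = p * j + (p - 1) := by
          have : m + 1 = p * (j + 1) := by rw [hr, pow_succ', hj]
          rw [mul_add] at this
          omega
        rw [if_pos ⟨_, hr⟩, if_pos (by omega), hm', Nat.add_sub_cancel, if_pos (Dvd.intro _ rfl),
          Nat.mul_div_cancel_left _ (by omega), if_pos ⟨r, hj.symm⟩]
    · rw [if_neg h]
      split_ifs with h1 h2 h3
      · obtain ⟨r, hr⟩ := h3
        obtain ⟨j, hj⟩ := h2
        rw [hj, Nat.mul_div_cancel_left _ (by omega)] at hr
        refine absurd ⟨r + 1, ?_⟩ h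
        rw [pow_succ', ← hr, mul_add]
        omega
      · rfl
      · rfl
      · rfl

section ArtinHasse

variable (p : ℕ) [Fact p.Prime]

open Classical in
/-- The Artin-Hasse exponential `exp (∑ X ^ (p ^ r) / p ^ r)` over `ℚ_p`. -/
noncomputable def artinHasseRat : PowerSeries ℚ_[p] :=
  (exp ℚ_[p]).subst
    (mk fun m => if ∃ r, m = p ^ r then (m : ℚ_[p])⁻¹ else 0)

theorem constantCoeff_artinHasseRat : constantCoeff (artinHasseRat p) = 1 := by
  rw [artinHasseRat, constantCoeff_subst_of_constantCoeff_eq_zero, constantCoeff_exp]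
  rw [← coeff_zero_eq_constantCoeff_apply, coeff_mk]
  simp

theorem derivative_artinHasseRat :
    d⁄dX _ (artinHasseRat p) = primePowerSeries p ℚ_[p] * artinHasseRat p := by
  rw [artinHasseRat, derivative_subst, derivative_exp, mul_comm]
  · congr 1
    ext m
    have hm : (m + 1 : ℚ_[p]) ≠ 0 := by exact_mod_cast m.succ_ne_zero
    rw [coeff_derivative, coeff_mk, primePowerSeries, coeff_mk]
    split_ifs
    · push_cast
      rw [inv_mul_cancel₀ hm]
    · rw [zero_mul]
  · apply HasSubst.of_constantCoeff_zero'
    rw [← coeff_zero_eq_constantCoeff_apply, coeff_mk]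
    simp

/-- The exponent L(X) = ∑ X^(p^r)/p^r satisfies p·L(X) = L(X^p) + pX. -/
theorem artinHasseRat_pow : artinHasseRat p ^ p =
    expand p (Fact.out : p.Prime).ne_zero (artinHasseRat p) * rescale (p : ℚ_[p]) (exp ℚ_[p]) := by
  have h := derivative_artinHasseRat p
  have he : d⁄dX _ (exp ℚ_[p]) = 1 * exp ℚ_[p] := by rw [derivative_exp, one_mul]
  refine eq_of_derivative_eq_mul (logDerivative_pow h p) ?_ ?_
  · rw [logDerivative_mul (logDerivative_expand h p (Fact.out : p.Prime).ne_zero)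
      (logDerivative_rescale he _)]
    congr 1
    conv_rhs => rw [primePowerSeries_eq p (Fact.out : p.Prime).one_lt]
    rw [map_one, map_natCast]
    ring
  · simp [constantCoeff_rescale, constantCoeff_artinHasseRat]

theorem coeff_rescale_exp_mem (m : ℕ) : ∃ z : ℤ_[p], coeff m (rescale (p : ℚ_[p]) (exp ℚ_[p])) =
    coeff m (1 : PowerSeries ℚ_[p]) + p * z := by
  rcases Nat.eq_zero_or_pos m with rfl | hm
  · exact ⟨0, by simp⟩
  · obtain ⟨z, hz⟩ := PadicInt.factorial_dvd_pow p hm.ne'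
    refine ⟨z, ?_⟩
    have hm' : (m.factorial : ℚ_[p]) ≠ 0 := by exact_mod_cast m.factorial_ne_zero
    have hz' := congrArg (algebraMap ℤ_[p] ℚ_[p]) hz
    rw [map_pow, map_mul, map_natCast, map_natCast] at hz'
    rw [coeff_rescale, coeff_exp, coeff_one, if_neg hm.ne', zero_add, map_div₀, map_one,
      map_natCast, ← Nat.sub_add_cancel hm, pow_succ, Nat.sub_add_cancel hm, hz']
    field_simp
    exact mul_comm _ _

theorem exists_padicInt_expand_sub_pow_eq (P : Polynomial ℤ_[p]) :
    ∃ G : Polynomial ℤ_[p], Polynomial.expand ℤ_[p] p P - P ^ p = Polynomial.C (p : ℤ_[p]) * G := by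
  apply (Polynomial.C_dvd_iff_dvd_coeff _ _).2
  intro i
  rw [← Ideal.mem_span_singleton, ← PadicInt.maximalIdeal_eq_span_p, ← PadicInt.ker_toZMod,
    RingHom.mem_ker, ← Polynomial.coeff_map, Polynomial.map_sub, Polynomial.map_pow,
    Polynomial.map_expand, ZMod.expand_card, sub_self, Polynomial.coeff_zero]

/-- Dwork's argument, by induction on m: compare the coefficients of X^m in A^p = A(X^p)·exp(pX).
With P the truncation of A below degree m, the left side gives that of P^p plus p times the unknown
coefficient. The right side gives that of P(X^p) plus a multiple of p, since exp(pX) ≡ 1 mod p. As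
P(X^p) ≡ P^p mod p, everything is divisible by p. -/
theorem coeff_artinHasseRat_mem (m : ℕ) : ∃ z : ℤ_[p], coeff m (artinHasseRat p) = z := by
  have hp : p.Prime := Fact.out
  induction m using Nat.strong_induction_on with
  | _ m ih =>
    rcases Nat.eq_zero_or_pos m with rfl | hm
    · exact ⟨1, by simp [constantCoeff_artinHasseRat]⟩
    choose! a ha using ih
    set φ : ℤ_[p] →+* ℚ_[p] := algebraMap ℤ_[p] ℚ_[p] with hφ
    have hφa (z : ℤ_[p]) : φ z = z := rfl
    obtain ⟨P, hP, hP'⟩ : ∃ P : Polynomial ℤ_[p],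
        (∀ i < m, φ (P.coeff i) = coeff i (artinHasseRat p)) ∧ ∀ i, m ≤ i → P.coeff i = 0 := by
      refine ⟨∑ i ∈ Finset.range m, Polynomial.monomial i (a i), fun i hi => ?_, fun i hi => ?_⟩
      · simp only [Polynomial.finsetSum_coeff, Polynomial.coeff_monomial]
        rw [Finset.sum_ite_eq', if_pos (Finset.mem_range.2 hi), ha i hi]
        rfl
      · simp only [Polynomial.finsetSum_coeff, Polynomial.coeff_monomial]
        rw [Finset.sum_ite_eq', if_neg (by simpa using hi)]
    obtain ⟨B, hB⟩ : ∃ B : PowerSeries ℚ_[p],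
        artinHasseRat p = map φ (P : PowerSeries ℤ_[p]) + X ^ m * B := by
      obtain ⟨B, hB⟩ := (X_pow_dvd_iff (n := m)
        (φ := artinHasseRat p - map φ (P : PowerSeries ℤ_[p]))).2 (fun i hi => by
          rw [map_sub, coeff_map, Polynomial.coeff_coe, hP i hi, sub_self])
      exact ⟨B, by rw [← hB]; ring⟩
    have hB0 : coeff m (artinHasseRat p) = constantCoeff B := by
      rw [hB, map_add, coeff_map, Polynomial.coeff_coe, hP' m le_rfl, map_zero, zero_add,
        coeff_X_pow_mul', if_pos le_rfl, Nat.sub_self, coeff_zero_eq_constantCoeff_apply]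
    have hP0 : constantCoeff (map φ (P : PowerSeries ℤ_[p])) = 1 := by
      rw [← coeff_zero_eq_constantCoeff_apply, coeff_map, Polynomial.coeff_coe, hP 0 hm,
        coeff_zero_eq_constantCoeff_apply, constantCoeff_artinHasseRat]
    obtain ⟨G, hG⟩ := exists_padicInt_expand_sub_pow_eq p P
    have hL : coeff m (artinHasseRat p ^ p) =
        φ ((P ^ p).coeff m) + p * coeff m (artinHasseRat p) := by
      -- The quadratic remainder has order at least 2m > m, and P has constant term 1, so only the
      -- linear term p·P^(p-1)·X^m·B adds to the coefficient of P^p, and it adds p·B(0).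
      obtain ⟨k, hk⟩ := Polynomial.powAddExpansion (map φ (P : PowerSeries ℤ_[p])) (X ^ m * B) p
      conv_lhs => rw [hB, hk]
      have e1 : (p : PowerSeries ℚ_[p]) * map φ (P : PowerSeries ℤ_[p]) ^ (p - 1) * (X ^ m * B) =
          X ^ m * ((p : PowerSeries ℚ_[p]) * map φ (P : PowerSeries ℤ_[p]) ^ (p - 1) * B) := by ring
      have e2 : k * (X ^ m * B) ^ 2 = X ^ (2 * m) * (k * B ^ 2) := by ring
      rw [map_add, map_add, e1, e2, coeff_X_pow_mul', if_pos le_rfl, coeff_X_pow_mul',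
        if_neg (by omega), Nat.sub_self, coeff_zero_eq_constantCoeff_apply, hB0, ← map_pow,
        coeff_map, ← Polynomial.coe_pow, Polynomial.coeff_coe]
      simp [hP0]
    have hR : ∃ z : ℤ_[p], coeff m (artinHasseRat p ^ p) =
        φ ((Polynomial.expand ℤ_[p] p P).coeff m) + p * φ z := by
      rw [artinHasseRat_pow]
      choose v hv using coeff_rescale_exp_mem p
      have hexp (i : ℕ) (hi : i ≤ m) :
          coeff i (expand p hp.ne_zero (artinHasseRat p)) =
            φ ((Polynomial.expand ℤ_[p] p P).coeff i) := by
        rw [coeff_expand, Polynomial.coeff_expand hp.pos]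
        split_ifs
        -- The index i / p is below m, so the truncation still agrees with A there.
        · rw [hP]
          rcases Nat.eq_zero_or_pos i with rfl | h0
          · simpa using hm
          · exact (Nat.div_lt_self h0 hp.one_lt).trans_le hi
        · simp
      refine ⟨∑ x ∈ Finset.HasAntidiagonal.antidiagonal m,
        (Polynomial.expand ℤ_[p] p P).coeff x.1 * v x.2, ?_⟩
      have e : rescale (p : ℚ_[p]) (exp ℚ_[p]) = 1 + C (p : ℚ_[p]) * mk fun i => φ (v i) := by
        ext i
        rw [hv, map_add, coeff_C_mul, coeff_mk]
        rfl
      rw [e, mul_add, mul_one, map_add, hexp m le_rfl, mul_left_comm, coeff_C_mul, coeff_mul,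
        map_sum]
      congr 2
      refine Finset.sum_congr rfl fun x hx => ?_
      rw [hexp _ (by have := Finset.HasAntidiagonal.mem_antidiagonal.1 hx; omega), coeff_mk,
        map_mul]
    obtain ⟨z, hz⟩ := hR
    refine ⟨G.coeff m + z, ?_⟩
    have hG' : φ (Polynomial.coeff _ m) = φ (Polynomial.coeff _ m) :=
      congrArg (fun T => φ (Polynomial.coeff T m)) hG
    rw [Polynomial.coeff_sub, map_sub, Polynomial.coeff_C_mul, map_mul, map_natCast] at hG'
    have hp0 : (p : ℚ_[p]) ≠ 0 := by exact_mod_cast hp.ne_zero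
    refine mul_left_cancel₀ hp0 ?_
    rw [← hφa, map_add]
    linear_combination -hL + hz + hG'

/-- The Artin-Hasse exponential over `ℤ_p`. -/
noncomputable def artinHasse : PowerSeries ℤ_[p] :=
  mk fun m => (coeff_artinHasseRat_mem p m).choose

theorem map_artinHasse : map (algebraMap ℤ_[p] ℚ_[p]) (artinHasse p) = artinHasseRat p := by
  ext m
  rw [coeff_map, artinHasse, coeff_mk]
  exact (coeff_artinHasseRat_mem p m).choose_spec.symm

theorem derivative_artinHasse :
    d⁄dX _ (artinHasse p) = primePowerSeries p ℤ_[p] * artinHasse p := by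
  apply map_injective (algebraMap ℤ_[p] ℚ_[p]) (IsFractionRing.injective _ _)
  rw [← derivative_map, map_mul, map_artinHasse, map_primePowerSeries, derivative_artinHasseRat]

theorem constantCoeff_artinHasse : constantCoeff (artinHasse p) = 1 := by
  apply IsFractionRing.injective ℤ_[p] ℚ_[p]
  have h := congrArg constantCoeff (map_artinHasse p)
  rw [constantCoeff_artinHasseRat] at h
  rw [map_one]
  exact h

end ArtinHasse

end PowerSeries

/-- Subadditivity of the weight makes the divisibility condition stable under products. The weight
used later is m ↦ ⌈m/p²⌉. -/
theorem PowerSeries.pow_dvd_coeff_mul {R : Type*} [CommRing R] {x : R} {w : ℕ → ℕ}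
    (hw : ∀ i j, w (i + j) ≤ w i + w j) {A B : PowerSeries R}
    (hA : ∀ m, x ^ w m ∣ PowerSeries.coeff m A) (hB : ∀ m, x ^ w m ∣ PowerSeries.coeff m B)
    (m : ℕ) : x ^ w m ∣ PowerSeries.coeff m (A * B) := by
  rw [PowerSeries.coeff_mul]
  refine Finset.dvd_sum fun y hy => ?_
  rw [← Finset.HasAntidiagonal.mem_antidiagonal.1 hy]
  exact (pow_dvd_pow x (hw _ _)).trans (pow_add x _ _ ▸ mul_dvd_mul (hA _) (hB _))

theorem PowerSeries.pow_dvd_coeff_pow {R : Type*} [CommRing R] {x : R} {w : ℕ → ℕ}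
    (hw : ∀ i j, w (i + j) ≤ w i + w j) (h0 : w 0 = 0) {A : PowerSeries R}
    (hA : ∀ m, x ^ w m ∣ PowerSeries.coeff m A) (k m : ℕ) :
    x ^ w m ∣ PowerSeries.coeff m (A ^ k) := by
  induction k generalizing m with
  | zero =>
    rw [pow_zero, PowerSeries.coeff_one]
    split_ifs with h
    · simp [h, h0]
    · exact dvd_zero _
  | succ k ih =>
    rw [pow_succ]
    exact PowerSeries.pow_dvd_coeff_mul hw ih hA m

theorem PowerSeries.dvd_coeff_subst {R : Type*} [CommRing R] {A g : PowerSeries R}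
    (hg : PowerSeries.constantCoeff g = 0) {x : R} {m : ℕ}
    (h : ∀ k, x ∣ PowerSeries.coeff k A * PowerSeries.coeff m (g ^ k)) :
    x ∣ PowerSeries.coeff m (A.subst g) := by
  rw [PowerSeries.coeff_subst' (PowerSeries.HasSubst.of_constantCoeff_zero' hg)]
  exact finsum_induction (x ∣ ·) (dvd_zero _) (fun _ _ => dvd_add) h

namespace DworkR

open PowerSeries

/-! ### Divisibility of the coefficients of θ by powers of π -/

section Estimate

variable (p : ℕ) [Fact p.Prime] (𝔽 : Type*) [Field 𝔽] [Finite 𝔽] [CharP 𝔽 p]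

theorem isUnit_natCast {u : ℕ} (hu : ¬ p ∣ u) : IsUnit (u : DworkR p 𝔽) := by
  have := (natCast_isUnit p 𝔽 u hu).map
    (AdjoinRoot.of ((Polynomial.X : Polynomial (WittVector p 𝔽)) ^ (p - 1)
      + Polynomial.C (p : WittVector p 𝔽)))
  rwa [map_natCast] at this

theorem natCast_eq : (p : DworkR p 𝔽) = -pi p 𝔽 ^ (p - 1) := by
  rw [pi_pow, neg_neg]

theorem pi_ne_zero : pi p 𝔽 ≠ 0 := by
  intro h
  have h1 := pi_pow p 𝔽
  have hp : (p : DworkR p 𝔽) ≠ 0 := by exact_mod_cast (Fact.out : p.Prime).ne_zero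
  rw [h, zero_pow (Nat.sub_pos_of_lt (Fact.out : p.Prime).one_lt).ne'] at h1
  exact hp (neg_eq_zero.1 h1.symm)

theorem pi_dvd_coeff_expPi {m : ℕ} (hm : m ≠ 0) : pi p 𝔽 ∣ coeff m (expPi p 𝔽) := by
  obtain ⟨v, u, huv, hu, hv⟩ := (Fact.out : p.Prime).exists_factorial_eq_pow_mul hm
  have h : (m.factorial : DworkR p 𝔽) ∣ pi p 𝔽 ^ (m - 1) := by
    rw [huv]
    push_cast
    rw [(isUnit_natCast p 𝔽 hu).mul_right_dvd, natCast_eq, neg_pow, ← pow_mul]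
    exact ((IsUnit.neg isUnit_one).pow v).mul_left_dvd.2 (pow_dvd_pow _ hv)
  obtain ⟨t, ht⟩ := h
  refine ⟨t, ?_⟩
  have hm' : (m.factorial : DworkR p 𝔽) ≠ 0 := by exact_mod_cast m.factorial_ne_zero
  refine mul_left_cancel₀ hm' ?_
  rw [factorial_mul_coeff_expPi, ← Nat.sub_add_cancel (Nat.pos_of_ne_zero hm), pow_succ,
    Nat.sub_add_cancel (Nat.pos_of_ne_zero hm), ht]
  ring

/-- The embedding of `ℤ_p` into `R`. -/
noncomputable def ofPadicInt : ℤ_[p] →+* DworkR p 𝔽 :=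
  (AdjoinRoot.of _).comp ((WittVector.map (ZMod.castHom (dvd_refl p) 𝔽)).comp
    (WittVector.equiv p).symm.toRingHom)

open Classical in
/-- The power series `-∑ π ^ (p ^ r - 1) / p ^ r * X ^ (p ^ r)`, where `r ≥ 2`. -/
noncomputable def tailSeries : PowerSeries (DworkR p 𝔽) :=
  mk fun m => if ∃ r, 2 ≤ r ∧ m = p ^ r then
    (-1) ^ (Nat.log p m + 1) * pi p 𝔽 ^ (m - 1 - Nat.log p m * (p - 1)) else 0

theorem coeff_tailSeries_pow {r : ℕ} (hr : 2 ≤ r) : coeff (p ^ r) (tailSeries p 𝔽) =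
    (-1) ^ (r + 1) * pi p 𝔽 ^ (p ^ r - 1 - r * (p - 1)) := by
  rw [tailSeries, coeff_mk, if_pos ⟨r, hr, rfl⟩, Nat.log_pow (Fact.out : p.Prime).one_lt]

theorem coeff_tailSeries_of_forall_ne {m : ℕ} (h : ∀ r, 2 ≤ r → m ≠ p ^ r) :
    coeff m (tailSeries p 𝔽) = 0 := by
  rw [tailSeries, coeff_mk, if_neg]
  rintro ⟨r, hr, hm⟩
  exact h r hr hm

theorem constantCoeff_tailSeries : constantCoeff (tailSeries p 𝔽) = 0 := by
  rw [← coeff_zero_eq_constantCoeff_apply]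
  exact coeff_tailSeries_of_forall_ne p 𝔽 fun r _ =>
    (pow_ne_zero _ (Fact.out : p.Prime).ne_zero).symm

/-- Equivalently, the exponent p^(r+2) - 1 - (r+2)(p-1) of π in the tail at degree p^(r+2) is at
least p^r, the degree divided by p². -/
theorem pow_add_mul_sub_one_lt_pow {r : ℕ} : p ^ r + (r + 2) * (p - 1) + 1 ≤ p ^ (r + 2) := by
  obtain ⟨s, hs⟩ := Nat.exists_eq_add_of_le' (Fact.out : p.Prime).one_le
  have hs1 : 1 ≤ s := by have := (Fact.out : p.Prime).two_le; omega
  rw [hs, Nat.add_sub_cancel]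
  induction r with
  | zero =>
    rw [pow_zero, zero_add]
    nlinarith
  | succ r ih =>
    have h1 : (s + 1) ^ (r + 1) = (s + 1) * (s + 1) ^ r := pow_succ' _ _
    have h2 : (s + 1) ^ (r + 1 + 2) = (s + 1) * (s + 1) ^ (r + 2) := pow_succ' _ _
    rw [h1, h2]
    nlinarith [Nat.mul_le_mul_left (s + 1) ih, mul_nonneg r.zero_le s.zero_le]

/-- The exponent is ⌈m/p²⌉. Only the degrees p^r with r ≥ 2 matter, and there it equals p^(r-2). -/
theorem pow_dvd_coeff_tailSeries (m : ℕ) :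
    pi p 𝔽 ^ ((m + (p ^ 2 - 1)) / p ^ 2) ∣ coeff m (tailSeries p 𝔽) := by
  by_cases h : ∃ r, 2 ≤ r ∧ m = p ^ r
  · obtain ⟨r, hr, rfl⟩ := h
    rw [coeff_tailSeries_pow p 𝔽 hr]
    obtain ⟨r, rfl⟩ := Nat.exists_eq_add_of_le' hr
    refine Dvd.dvd.mul_left (pow_dvd_pow _ ?_) _
    have h1 := pow_add_mul_sub_one_lt_pow p (r := r)
    have hp2 : 0 < p ^ 2 := pow_pos (Fact.out : p.Prime).pos 2
    have h2 : (p ^ (r + 2) + (p ^ 2 - 1)) / p ^ 2 = p ^ r := by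
      rw [pow_add, mul_comm, Nat.mul_add_div hp2, Nat.div_eq_of_lt (by omega), add_zero]
    rw [h2]
    omega
  · rw [coeff_tailSeries_of_forall_ne p 𝔽 (fun r hr hm => h ⟨r, hr, hm⟩)]
    exact dvd_zero _

theorem pi_dvd_coeff_tailSeries (m : ℕ) : pi p 𝔽 ∣ coeff m (tailSeries p 𝔽) := by
  rcases Nat.eq_zero_or_pos m with rfl | hm
  · rw [coeff_zero_eq_constantCoeff_apply, constantCoeff_tailSeries]
    exact dvd_zero _
  · refine (dvd_pow_self _ ?_).trans (pow_dvd_coeff_tailSeries p 𝔽 m)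
    have hp2 : 0 < p ^ 2 := pow_pos (Fact.out : p.Prime).pos 2
    exact (Nat.div_pos (by omega) hp2).ne'

/-- In ∑ (πX)^(p^r)/p^r the term r = 0 is πX, and the term r = 1 is -πX^p because π^(p-1) = -p.
Hence πX - πX^p is this sum without its terms r ≥ 2, and π times the tail series removes exactly
those. The proof matches logarithmic derivatives in the cases r = 0, 1 and r ≥ 2. -/
theorem theta_eq_artinHasse_mul : theta p 𝔽 =
    rescale (pi p 𝔽) (map (ofPadicInt p 𝔽) (artinHasse p)) *
      (expPi p 𝔽).subst (tailSeries p 𝔽) := by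
  have hp : p.Prime := Fact.out
  have hA : d⁄dX _ (map (ofPadicInt p 𝔽) (artinHasse p)) =
      primePowerSeries p (DworkR p 𝔽) * map (ofPadicInt p 𝔽) (artinHasse p) := by
    rw [derivative_map, derivative_artinHasse, map_mul, map_primePowerSeries]
  have hsub : HasSubst (tailSeries p 𝔽) :=
    HasSubst.of_constantCoeff_zero' (constantCoeff_tailSeries p 𝔽)
  have hE : d⁄dX _ ((expPi p 𝔽).subst (tailSeries p 𝔽)) =
      (C (pi p 𝔽) * d⁄dX _ (tailSeries p 𝔽)) * (expPi p 𝔽).subst (tailSeries p 𝔽) := by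
    rw [derivative_subst hsub, derivative_expPi, subst_mul hsub, subst_C]
    change C _ * _ * _ = _
    ring
  refine eq_of_derivative_eq_mul (logDerivative_theta p 𝔽) ?_ ?_
  · rw [logDerivative_mul (logDerivative_rescale hA _) hE]
    congr 1
    ext m
    rw [map_add, map_sub, coeff_C_mul, coeff_C_mul, coeff_C_mul, coeff_rescale,
      coeff_derivative, coeff_C, coeff_X_pow, primePowerSeries, coeff_mk]
    by_cases h : ∃ r, m + 1 = p ^ r
    · rw [if_pos h]
      obtain ⟨r, hr⟩ := h
      have hm : m = p ^ r - 1 := by omega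
      match r with
      | 0 =>
        rw [pow_zero] at hm
        rw [Nat.sub_self] at hm
        subst hm
        rw [coeff_tailSeries_of_forall_ne, if_pos rfl, if_neg (Nat.sub_pos_of_lt hp.one_lt).ne]
        · simp
        · intro r hr' h
          have := Nat.one_lt_pow (show r ≠ 0 by omega) hp.one_lt
          omega
      | 1 =>
        rw [pow_one] at hm
        rw [coeff_tailSeries_of_forall_ne, if_neg (by have := hp.one_lt; omega), if_pos hm, hm,
          pi_pow]
        · ring
        · intro r hr' h
          rw [hr] at h
          have := Nat.pow_right_injective hp.two_le h
          omega
      | r + 2 =>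
        have hb := pow_add_mul_sub_one_lt_pow p (r := r)
        have hlt : p < p ^ (r + 2) := by
          conv_lhs => rw [← pow_one p]
          exact Nat.pow_lt_pow_right hp.one_lt (by omega)
        have h1 : (m + 1 : DworkR p 𝔽) = (-1) ^ (r + 2) * pi p 𝔽 ^ ((r + 2) * (p - 1)) := by
          have : (m + 1 : DworkR p 𝔽) = ((m + 1 : ℕ) : DworkR p 𝔽) := by push_cast; rfl
          rw [this, hr, Nat.cast_pow, natCast_eq, neg_pow, mul_comm (r + 2), pow_mul]
        have ht := coeff_tailSeries_pow p 𝔽 (r := r + 2) (by omega)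
        rw [← hr] at hb hlt ht
        have hp1 := hp.one_lt
        obtain ⟨e, he⟩ : ∃ e, e = (r + 2) * (p - 1) := ⟨_, rfl⟩
        rw [← he] at hb ht h1
        obtain ⟨l, hl⟩ : ∃ l, m = l + e := ⟨m - e, by omega⟩
        rw [if_neg (by omega), if_neg (by omega), h1, ht, show m + 1 - 1 - e = l by omega]
        have h3 : ((-1 : DworkR p 𝔽) ^ (r + 2)) * (-1) ^ (r + 2) = 1 := by
          rw [← mul_pow]; simp
        rw [hl, pow_add, pow_succ _ (r + 2)]
        linear_combination -pi p 𝔽 * pi p 𝔽 ^ l * pi p 𝔽 ^ e * h3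
    · have h0 : m ≠ 0 := by rintro rfl; exact h ⟨0, by simp⟩
      have h1 : m ≠ p - 1 := by rintro rfl; exact h ⟨1, by have := hp.one_lt; simp; omega⟩
      rw [if_neg h, if_neg h0, if_neg h1,
        coeff_tailSeries_of_forall_ne p 𝔽 (fun r _ hm => h ⟨r, hm⟩)]
      simp
  · rw [constantCoeff_theta, map_mul, constantCoeff_rescale,
      constantCoeff_subst_of_constantCoeff_eq_zero _ (constantCoeff_tailSeries p 𝔽),
      constantCoeff_expPi, mul_one]
    change 1 = ofPadicInt p 𝔽 (constantCoeff (artinHasse p))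
    rw [constantCoeff_artinHasse, map_one]

/-- The coefficients of `θ` tend to zero. -/
theorem pow_dvd_coeff_theta (m : ℕ) :
    pi p 𝔽 ^ ((m + (p ^ 2 - 1)) / p ^ 2) ∣ coeff m (theta p 𝔽) := by
  have hp2 : 0 < p ^ 2 := pow_pos (Fact.out : p.Prime).pos 2
  have hw : ∀ i j, (i + j + (p ^ 2 - 1)) / p ^ 2 ≤
      (i + (p ^ 2 - 1)) / p ^ 2 + (j + (p ^ 2 - 1)) / p ^ 2 := by
    intro i j
    have h1 := Nat.lt_mul_div_succ (i + (p ^ 2 - 1)) hp2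
    have h2 := Nat.lt_mul_div_succ (j + (p ^ 2 - 1)) hp2
    rw [← Nat.lt_add_one_iff, Nat.div_lt_iff_lt_mul hp2]
    rw [mul_add, mul_one] at h1 h2
    rw [add_mul, add_mul, one_mul, mul_comm _ (p ^ 2), mul_comm _ (p ^ 2)]
    omega
  have h0 : (0 + (p ^ 2 - 1)) / p ^ 2 = 0 := Nat.div_eq_of_lt (by omega)
  rw [theta_eq_artinHasse_mul]
  refine pow_dvd_coeff_mul (w := fun m => (m + (p ^ 2 - 1)) / p ^ 2) hw (fun m => ?_)
    (fun m => ?_) m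
  · rw [coeff_rescale]
    refine Dvd.dvd.mul_right (pow_dvd_pow _ ?_) _
    rw [← Nat.lt_add_one_iff, Nat.div_lt_iff_lt_mul hp2]
    have := Nat.le_mul_of_pos_right m hp2
    rw [add_mul]
    omega
  · refine dvd_coeff_subst (constantCoeff_tailSeries p 𝔽) fun k => Dvd.dvd.mul_left ?_ _
    exact pow_dvd_coeff_pow (w := fun m => (m + (p ^ 2 - 1)) / p ^ 2) hw h0
      (pow_dvd_coeff_tailSeries p 𝔽) k m

theorem coeff_one_theta : coeff 1 (theta p 𝔽) = pi p 𝔽 := by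
  have hp : p.Prime := Fact.out
  have h := congrArg (coeff 0) (logDerivative_theta p 𝔽)
  simpa [coeff_derivative, constantCoeff_theta, (Nat.sub_pos_of_lt hp.one_lt).ne'] using h

/-- The degree i coefficient of the Artin-Hasse factor carries π^i, and the other factor is 1 modulo
π²: one π comes from exp(πz), one from the tail series. -/
theorem pi_sq_dvd_coeff_theta {m : ℕ} (hm : 2 ≤ m) : pi p 𝔽 ^ 2 ∣ coeff m (theta p 𝔽) := by
  rw [theta_eq_artinHasse_mul, coeff_mul]
  refine Finset.dvd_sum fun y hy => ?_
  have hy' := Finset.HasAntidiagonal.mem_antidiagonal.1 hy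
  rcases Nat.eq_zero_or_pos y.2 with h0 | h0
  · rw [coeff_rescale]
    exact ((pow_dvd_pow _ (by omega)).mul_right _).mul_right _
  · refine Dvd.dvd.mul_left (dvd_coeff_subst (constantCoeff_tailSeries p 𝔽) fun k => ?_) _
    cases k with
    | zero => simp [coeff_one, h0.ne']
    | succ k =>
      rw [sq]
      refine mul_dvd_mul (pi_dvd_coeff_expPi p 𝔽 k.succ_ne_zero) ?_
      rw [pow_succ, coeff_mul]
      exact Finset.dvd_sum fun z _ => (pi_dvd_coeff_tailSeries p 𝔽 _).mul_left _

end Estimate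

end DworkR

namespace PowerSeries

/-! ### Values of power series that are polynomials -/

section EvalOne

variable {S : Type*} [CommRing S]

theorem exists_polynomial_coe_eq {A : PowerSeries S} {n : ℕ} (h : ∀ m, n ≤ m → coeff m A = 0) :
    ∃ T : Polynomial S, (T : PowerSeries S) = A := by
  refine ⟨trunc n A, ?_⟩
  ext m
  rw [Polynomial.coeff_coe, coeff_trunc]
  split_ifs with hm
  · rfl
  · exact (h m (not_lt.1 hm)).symm

/-- The sum of the coefficients of a power series which has only finitely many non-zero ones. -/
noncomputable def evalOne (A : PowerSeries S) : S := ∑ᶠ m, coeff m A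

theorem evalOne_coe (T : Polynomial S) : evalOne (T : PowerSeries S) = T.eval 1 := by
  rw [evalOne, Polynomial.eval_eq_sum, Polynomial.sum,
    finsum_eq_sum_of_support_subset (s := T.support)]
  · simp
  · intro m hm
    simpa using hm

/-- Evaluation at c is evaluation at 1 after rescaling, so identities between rescaled series become
identities between values. -/
theorem evalOne_rescale {A : PowerSeries S} {T : Polynomial S} (hT : (T : PowerSeries S) = A)
    (c : S) : evalOne (rescale c A) = T.eval c := by
  have h : rescale c A = (T.comp (Polynomial.C c * Polynomial.X) : Polynomial S) := by
    ext m
    rw [coeff_rescale, ← hT, Polynomial.coeff_coe, Polynomial.coeff_coe,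
      Polynomial.comp_C_mul_X_coeff, mul_comm]
  rw [h, evalOne_coe]
  simp

theorem evalOne_mul {A B : PowerSeries S} (hA : ∃ T : Polynomial S, (T : PowerSeries S) = A)
    (hB : ∃ T : Polynomial S, (T : PowerSeries S) = B) :
    evalOne (A * B) = evalOne A * evalOne B := by
  obtain ⟨T, rfl⟩ := hA
  obtain ⟨U, rfl⟩ := hB
  rw [← Polynomial.coe_mul, evalOne_coe, evalOne_coe, evalOne_coe, Polynomial.eval_mul]

theorem expand_coe (k : ℕ) (hk : k ≠ 0) (T : Polynomial S) :
    expand k hk (T : PowerSeries S) = (Polynomial.expand S k T : Polynomial S) := by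
  ext m
  rw [coeff_expand, Polynomial.coeff_coe, Polynomial.coeff_coe,
    Polynomial.coeff_expand (Nat.pos_of_ne_zero hk)]

theorem evalOne_expand (k : ℕ) (hk : k ≠ 0) {A : PowerSeries S}
    (hA : ∃ T : Polynomial S, (T : PowerSeries S) = A) :
    evalOne (expand k hk A) = evalOne A := by
  obtain ⟨T, rfl⟩ := hA
  rw [expand_coe, evalOne_coe, evalOne_coe, Polynomial.expand_eval, one_pow]

theorem exists_polynomial_rescale {A : PowerSeries S}
    (hA : ∃ T : Polynomial S, (T : PowerSeries S) = A) (c : S) :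
    ∃ T : Polynomial S, (T : PowerSeries S) = rescale c A := by
  obtain ⟨T, rfl⟩ := hA
  refine ⟨T.comp (Polynomial.C c * Polynomial.X), ?_⟩
  ext m
  rw [coeff_rescale, Polynomial.coeff_coe, Polynomial.coeff_coe,
    Polynomial.comp_C_mul_X_coeff, mul_comm]

theorem exists_polynomial_expand {A : PowerSeries S}
    (hA : ∃ T : Polynomial S, (T : PowerSeries S) = A) (k : ℕ) (hk : k ≠ 0) :
    ∃ T : Polynomial S, (T : PowerSeries S) = expand k hk A := by
  obtain ⟨T, rfl⟩ := hA
  exact ⟨_, (expand_coe k hk T).symm⟩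

theorem exists_polynomial_mul {A B : PowerSeries S}
    (hA : ∃ T : Polynomial S, (T : PowerSeries S) = A)
    (hB : ∃ T : Polynomial S, (T : PowerSeries S) = B) :
    ∃ T : Polynomial S, (T : PowerSeries S) = A * B := by
  obtain ⟨T, rfl⟩ := hA
  obtain ⟨U, rfl⟩ := hB
  exact ⟨_, Polynomial.coe_mul T U⟩

theorem map_rescale {R : Type*} [CommRing R] (ψ : R →+* S) (c : R) (A : PowerSeries R) :
    map ψ (rescale c A) = rescale (ψ c) (map ψ A) := by
  ext m
  simp

end EvalOne

end PowerSeries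

namespace DworkR

open PowerSeries

/-! ### Teichmüller liftings in R -/

section Teich

/-- The embedding of the Witt vectors into `R`. -/
noncomputable abbrev ofWitt (p : ℕ) [Fact p.Prime] (𝔽 : Type*) [CommRing 𝔽] :
    WittVector p 𝔽 →+* DworkR p 𝔽 := AdjoinRoot.of _

variable (p : ℕ) [Fact p.Prime] {𝔽 : Type*} [Field 𝔽]

theorem teich_mul (s t : 𝔽) : teich p 𝔽 (s * t) = teich p 𝔽 s * teich p 𝔽 t := by
  simp [teich]

theorem teich_zero : teich p 𝔽 0 = 0 := by
  simp [teich]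

theorem teich_one : teich p 𝔽 1 = 1 := by
  simp [teich]

theorem teich_pow (t : 𝔽) (m : ℕ) : teich p 𝔽 (t ^ m) = teich p 𝔽 t ^ m := by
  simp [teich]

theorem exists_eq_natCast_mul [CharP 𝔽 p] [Finite 𝔽] {x : WittVector p 𝔽}
    (hx : WittVector.constantCoeff x = 0) : ∃ w, x = p * w := by
  change x.coeff 0 = 0 at hx
  rw [← WittVector.mem_span_p_iff_coeff_zero_eq_zero, Ideal.mem_span_singleton] at hx
  exact hx

theorem exists_teich_add_eq [CharP 𝔽 p] [Finite 𝔽] (s t : 𝔽) :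
    ∃ w, teich p 𝔽 (s + t) = teich p 𝔽 s + teich p 𝔽 t + p * w := by
  have h0 : (WittVector.constantCoeff : WittVector p 𝔽 →+* 𝔽) (WittVector.teichmuller p (s + t) -
      WittVector.teichmuller p s - WittVector.teichmuller p t) = 0 := by
    rw [map_sub, map_sub]
    change (WittVector.teichmuller p _).coeff 0 - (WittVector.teichmuller p _).coeff 0 -
      (WittVector.teichmuller p _).coeff 0 = 0
    simp
  obtain ⟨w, hw⟩ := exists_eq_natCast_mul p h0
  refine ⟨ofWitt p 𝔽 w, ?_⟩
  have h := congrArg (ofWitt p 𝔽) hw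
  rw [map_sub, map_sub, map_mul, map_natCast (ofWitt p 𝔽)] at h
  change ofWitt p 𝔽 _ = ofWitt p 𝔽 _ + ofWitt p 𝔽 _ + _
  linear_combination h

end Teich

/-! ### The additive character built from θ -/

section Character

variable {p : ℕ} [Fact p.Prime] {𝔽 : Type*} [Field 𝔽] [Finite 𝔽] [CharP 𝔽 p]
  {S : Type*} [CommRing S] (ψ : DworkR p 𝔽 →+* S)

theorem exists_polynomial_theta (h : IsNilpotent (ψ (pi p 𝔽))) :
    ∃ T : Polynomial S, (T : PowerSeries S) = map ψ (theta p 𝔽) := by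
  obtain ⟨M, hM⟩ := h
  refine exists_polynomial_coe_eq (n := p ^ 2 * M) fun m hm => ?_
  obtain ⟨c, hc⟩ := pow_dvd_coeff_theta p 𝔽 m
  have hp2 : 0 < p ^ 2 := pow_pos (Fact.out : p.Prime).pos 2
  have hle : M ≤ (m + (p ^ 2 - 1)) / p ^ 2 :=
    (Nat.le_div_iff_mul_le hp2).2 (by rw [mul_comm]; omega)
  rw [coeff_map, hc, map_mul, map_pow, pow_eq_zero_of_le hle hM, zero_mul]

theorem isNilpotent_natCast (h : IsNilpotent (ψ (pi p 𝔽))) : IsNilpotent (p : S) := by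
  rw [← map_natCast ψ, natCast_eq, map_neg, isNilpotent_neg_iff, map_pow]
  exact h.pow_of_pos (Nat.sub_pos_of_lt (Fact.out : p.Prime).one_lt).ne'

theorem exists_polynomial_expPi (h : IsNilpotent (ψ (pi p 𝔽))) (c : DworkR p 𝔽) :
    ∃ T : Polynomial S, (T : PowerSeries S) = map ψ (rescale (p * c) (expPi p 𝔽)) := by
  obtain ⟨M, hM⟩ := isNilpotent_natCast ψ h
  refine exists_polynomial_coe_eq (n := M) fun m hm => ?_
  rw [coeff_map, coeff_rescale, map_mul, map_pow, map_mul, map_natCast, mul_pow,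
    pow_eq_zero_of_le hm hM, zero_mul, zero_mul]

/-- The value of `exp (π p c)`. -/
noncomputable def expVal (c : DworkR p 𝔽) : S := evalOne (map ψ (rescale (p * c) (expPi p 𝔽)))

theorem expVal_zero : expVal ψ 0 = 1 := by
  have h : map ψ (rescale ((p : DworkR p 𝔽) * 0) (expPi p 𝔽)) =
      ((1 : Polynomial S) : PowerSeries S) := by
    ext m
    rw [mul_zero, coeff_map, coeff_rescale, Polynomial.coe_one, coeff_one]
    split_ifs with hm
    · simp [hm, constantCoeff_expPi]
    · simp [hm]
  rw [expVal, h, evalOne_coe, Polynomial.eval_one]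

variable {ψ}

theorem expVal_add (h : IsNilpotent (ψ (pi p 𝔽))) (c d : DworkR p 𝔽) :
    expVal ψ (c + d) = expVal ψ c * expVal ψ d := by
  rw [expVal, mul_add, rescale_add_expPi, map_mul,
    evalOne_mul (exists_polynomial_expPi ψ h c) (exists_polynomial_expPi ψ h d)]
  rfl

theorem prod_expVal_sub (h : IsNilpotent (ψ (pi p 𝔽))) (w : ℕ → DworkR p 𝔽) (m : ℕ) :
    ∏ i ∈ Finset.range m, expVal ψ (w i - w (i + 1)) = expVal ψ (w 0 - w m) := by
  induction m with
  | zero => simp [expVal_zero]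
  | succ m ih =>
    rw [Finset.prod_range_succ, ih, ← expVal_add h]
    congr 1
    ring

variable {T : Polynomial S}

theorem eval_theta_add (h : IsNilpotent (ψ (pi p 𝔽)))
    (hT : (T : PowerSeries S) = map ψ (theta p 𝔽)) {x y c : DworkR p 𝔽}
    (hc : x ^ p + y ^ p - (x + y) ^ p = p * c) :
    T.eval (ψ (x + y)) = T.eval (ψ x) * T.eval (ψ y) * expVal ψ c := by
  have hE := exists_polynomial_expPi ψ h c
  have hr (z : S) := exists_polynomial_rescale ⟨T, hT⟩ z
  rw [← evalOne_rescale hT, ← map_rescale, rescale_add_theta hc, map_mul, map_mul, map_rescale,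
    map_rescale, map_expand, evalOne_mul (exists_polynomial_mul (hr _) (hr _))
    (exists_polynomial_expand hE _ _), evalOne_mul (hr _) (hr _), evalOne_expand _ _ hE,
    evalOne_rescale hT, evalOne_rescale hT, expVal]

theorem eval_theta_natCast_mul (h : IsNilpotent (ψ (pi p 𝔽)))
    (hT : (T : PowerSeries S) = map ψ (theta p 𝔽)) (w : DworkR p 𝔽) :
    T.eval (ψ (p * w)) = expVal ψ (w - p ^ (p - 1) * w ^ p) := by
  have hpow : -((p : DworkR p 𝔽) * w) ^ p = p * (-(p ^ (p - 1) * w ^ p)) := by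
    have h1 : (p : DworkR p 𝔽) ^ p = p * p ^ (p - 1) := by
      rw [← pow_succ', Nat.sub_add_cancel (Fact.out : p.Prime).one_le]
    rw [mul_pow, h1]
    ring
  have hE := exists_polynomial_expPi ψ h
  rw [← evalOne_rescale hT, ← map_rescale, rescale_theta_eq, hpow, map_mul, map_expand,
    evalOne_mul (hE _) (exists_polynomial_expand (hE _) _ _), evalOne_expand _ _ (hE _),
    sub_eq_add_neg, expVal_add h]
  rfl

/-- Formally log θ(x) = π(x - x^p), and subtracting the hypotheses gives x - x^p = (y - y^p) + (z -
z^p) + p(w - w'). The exponentials of the separate terms need not make sense as values, so the proof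
applies the addition formula twice, with exact corrections. -/
theorem eval_theta_add_add (h : IsNilpotent (ψ (pi p 𝔽)))
    (hT : (T : PowerSeries S) = map ψ (theta p 𝔽)) {x y z w w' : DworkR p 𝔽}
    (hx : x = y + z + p * w) (hw' : x ^ p = y ^ p + z ^ p + p * w') :
    T.eval (ψ x) = T.eval (ψ y) * T.eval (ψ z) * expVal ψ (w - w') := by
  have hp : p.Prime := Fact.out
  obtain ⟨r₁, h₁⟩ := exists_add_pow_prime_eq hp y z
  obtain ⟨r₂, h₂⟩ := exists_add_pow_prime_eq hp (y + z) (p * w)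
  have e₁ : y ^ p + z ^ p - (y + z) ^ p = p * (-(y * z * r₁)) := by rw [h₁]; ring
  have e₂ : (y + z) ^ p + (p * w) ^ p - (y + z + p * w) ^ p = p * (-((y + z) * (p * w) * r₂)) := by
    rw [h₂]; ring
  have hp0 : (p : DworkR p 𝔽) ≠ 0 := by exact_mod_cast hp.ne_zero
  have hpow : ((p : DworkR p 𝔽) * w) ^ p = p * (p ^ (p - 1) * w ^ p) := by
    have h1 : (p : DworkR p 𝔽) ^ p = p * p ^ (p - 1) := by
      rw [← pow_succ', Nat.sub_add_cancel (Fact.out : p.Prime).one_le]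
    rw [mul_pow, h1]
    ring
  -- The three corrections, from y + z, from θ(pw) and from adding pw, sum to w - w'; this is
  -- checked after multiplying by p.
  have key : w - w' = -(y * z * r₁) + (w - p ^ (p - 1) * w ^ p) + -((y + z) * (p * w) * r₂) := by
    refine mul_left_cancel₀ hp0 ?_
    rw [hx] at hw'
    linear_combination hw' + e₁ + e₂ - hpow
  rw [hx, eval_theta_add h hT e₂, eval_theta_add h hT e₁, eval_theta_natCast_mul h hT, key,
    expVal_add h, expVal_add h]
  ring

/-- The product of the values of `θ` at the conjugates of the Teichmüller lifting of `t`. -/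
noncomputable def thetaProd (ψ : DworkR p 𝔽 →+* S) (T : Polynomial S) (b : ℕ) (t : 𝔽) : S :=
  ∏ i ∈ Finset.range b, T.eval (ψ (teich p 𝔽 t ^ p ^ i))

theorem thetaProd_zero (hT : (T : PowerSeries S) = map ψ (theta p 𝔽)) (b : ℕ) :
    thetaProd ψ T b 0 = 1 := by
  refine Finset.prod_eq_one fun i _ => ?_
  rw [teich_zero, zero_pow (pow_ne_zero _ (Fact.out : p.Prime).ne_zero), map_zero,
    ← Polynomial.coeff_zero_eq_eval_zero, ← Polynomial.coeff_coe, hT, coeff_map,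
    coeff_zero_eq_constantCoeff_apply, constantCoeff_theta, map_one]

/-- Raising the i-th relation between Teichmüller powers to the p-th power of each term gives the
(i+1)-st. The i-th factor thus contributes the correction exp(πp(w i - w (i+1))), and the product
telescopes to exp(πp(w 0 - w b)). -/
theorem thetaProd_add (h : IsNilpotent (ψ (pi p 𝔽)))
    (hT : (T : PowerSeries S) = map ψ (theta p 𝔽)) {b : ℕ} (hb : ∀ t : 𝔽, t ^ p ^ b = t)
    (s t : 𝔽) : thetaProd ψ T b (s + t) = thetaProd ψ T b s * thetaProd ψ T b t := by
  have hp0 : (p : DworkR p 𝔽) ≠ 0 := by exact_mod_cast (Fact.out : p.Prime).ne_zero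
  have hw (i : ℕ) : ∃ w, teich p 𝔽 (s + t) ^ p ^ i =
      teich p 𝔽 s ^ p ^ i + teich p 𝔽 t ^ p ^ i + p * w := by
    have := exists_teich_add_eq p (s ^ p ^ i) (t ^ p ^ i)
    rwa [← add_pow_char_pow, teich_pow, teich_pow, teich_pow] at this
  choose w hw using hw
  -- The orbit closes up: t^(p^b) = t makes the relations for i = b and i = 0 the same.
  have hwb : w b = w 0 := by
    refine mul_left_cancel₀ hp0 ?_
    have h1 := hw b
    have h2 := hw 0
    rw [← teich_pow, ← teich_pow, ← teich_pow, hb, hb, hb] at h1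
    rw [pow_zero, pow_one, pow_one, pow_one] at h2
    linear_combination h2 - h1
  have hprod := prod_expVal_sub h w b
  rw [hwb, sub_self, expVal_zero] at hprod
  rw [thetaProd, thetaProd, thetaProd, ← mul_one (_ * _), ← hprod, ← Finset.prod_mul_distrib,
    ← Finset.prod_mul_distrib]
  refine Finset.prod_congr rfl fun i _ => eval_theta_add_add h hT (hw i) ?_
  rw [← pow_mul, ← pow_mul, ← pow_mul, ← pow_succ]
  exact hw (i + 1)

theorem exists_eval_theta_eq (hT : (T : PowerSeries S) = map ψ (theta p 𝔽)) (x : S) :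
    ∃ y, T.eval x = 1 + ψ (pi p 𝔽) * x + ψ (pi p 𝔽) ^ 2 * y := by
  have hU : Polynomial.C (ψ (pi p 𝔽) ^ 2) ∣ T - (1 + Polynomial.C (ψ (pi p 𝔽)) * Polynomial.X) := by
    rw [Polynomial.C_dvd_iff_dvd_coeff]
    intro m
    rw [Polynomial.coeff_sub, ← Polynomial.coeff_coe, hT, coeff_map, Polynomial.coeff_add,
      Polynomial.coeff_one, Polynomial.coeff_C_mul, Polynomial.coeff_X]
    match m with
    | 0 => simp [constantCoeff_theta]
    | 1 => simp [coeff_one_theta]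
    | m + 2 =>
      have := map_dvd ψ (pi_sq_dvd_coeff_theta p 𝔽 (m := m + 2) (by omega))
      rw [map_pow] at this
      simpa using this
  obtain ⟨U, hU⟩ := hU
  refine ⟨U.eval x, ?_⟩
  have := congrArg (Polynomial.eval x) hU
  simp only [Polynomial.eval_sub, Polynomial.eval_add, Polynomial.eval_mul, Polynomial.eval_C,
    Polynomial.eval_X, Polynomial.eval_one] at this
  linear_combination this

theorem exists_prod_one_add_eq {ι : Type*} (s : Finset ι) (c : S) (x y : ι → S) :
    ∃ z, ∏ i ∈ s, (1 + c * x i + c ^ 2 * y i) = 1 + c * ∑ i ∈ s, x i + c ^ 2 * z := by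
  classical
  induction s using Finset.induction_on with
  | empty => exact ⟨0, by simp⟩
  | insert i s hi ih =>
    obtain ⟨z, hz⟩ := ih
    rw [Finset.prod_insert hi, Finset.sum_insert hi, hz]
    exact ⟨z + x i * (∑ i ∈ s, x i) + c * x i * z + y i * (1 + c * ∑ i ∈ s, x i + c ^ 2 * z), by
      ring⟩

/-- The trace polynomial has degree at most p^(b-1) < p^b and coefficient 1 at X, so it cannot
vanish on the whole field. -/
theorem exists_sum_pow_ne_zero {b : ℕ} (hb0 : b ≠ 0) (hb : Nat.card 𝔽 = p ^ b) :
    ∃ t : 𝔽, ∑ i ∈ Finset.range b, t ^ p ^ i ≠ 0 := by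
  have hp : p.Prime := Fact.out
  by_contra! hcon
  have := Fintype.ofFinite 𝔽
  let P : Polynomial 𝔽 := ∑ i ∈ Finset.range b, Polynomial.X ^ p ^ i
  have hP : P = 0 := by
    refine Polynomial.eq_zero_of_natDegree_lt_card_of_eval_eq_zero P
      (f := (id : 𝔽 → 𝔽)) Function.injective_id (fun t => ?_) ?_
    · simpa [P, Polynomial.eval_finsetSum] using hcon t
    · rw [← Nat.card_eq_fintype_card, hb]
      refine lt_of_le_of_lt (Polynomial.natDegree_sum_le_of_forall_le (n := p ^ (b - 1)) _ _
        fun i hi => ?_) (Nat.pow_lt_pow_right hp.one_lt (by omega))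
      rw [Polynomial.natDegree_X_pow]
      exact Nat.pow_le_pow_right hp.pos (by have := Finset.mem_range.1 hi; omega)
  have h1 := congrArg (fun Q => Polynomial.coeff Q 1) hP
  simp only [P, Polynomial.finsetSum_coeff, Polynomial.coeff_X_pow, Polynomial.coeff_zero] at h1
  rw [Finset.sum_eq_single 0] at h1
  · simp at h1
  · intro i _ hi
    rw [if_neg (Nat.one_lt_pow hi hp.one_lt).ne]
  · intro h
    exact absurd (Finset.mem_range.2 (Nat.pos_of_ne_zero hb0)) h

/-- Since θ(x) ≡ 1 + πx mod π², the product is 1 + π·(sum of the conjugates of `teich t`) mod π².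
That sum reduces to the trace of t, so it is a unit when the trace is non-zero. -/
theorem exists_thetaProd_eq (h : IsNilpotent (ψ (pi p 𝔽)))
    (hT : (T : PowerSeries S) = map ψ (theta p 𝔽)) {b : ℕ} (hb0 : b ≠ 0)
    (hb : Nat.card 𝔽 = p ^ b) :
    ∃ t : 𝔽, ∃ u : S, IsUnit u ∧ thetaProd ψ T b t = 1 + ψ (pi p 𝔽) * u := by
  obtain ⟨t, ht⟩ := exists_sum_pow_ne_zero (p := p) hb0 hb
  choose y hy using exists_eval_theta_eq (T := T) hT
  obtain ⟨z, hz⟩ := exists_prod_one_add_eq (Finset.range b) (ψ (pi p 𝔽))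
    (fun i => ψ (teich p 𝔽 t ^ p ^ i)) (fun i => y (ψ (teich p 𝔽 t ^ p ^ i)))
  refine ⟨t, ∑ i ∈ Finset.range b, ψ (teich p 𝔽 t ^ p ^ i) + ψ (pi p 𝔽) * z, ?_, ?_⟩
  · have hu : IsUnit (∑ i ∈ Finset.range b, WittVector.teichmuller p t ^ p ^ i) := by
      apply WittVector.isUnit_of_coeff_zero_ne_zero
      change WittVector.constantCoeff _ ≠ 0
      rw [map_sum]
      simp only [map_pow]
      change ∑ i ∈ Finset.range b, (WittVector.teichmuller p t).coeff 0 ^ p ^ i ≠ 0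
      simpa using ht
    have hu' := (hu.map (ofWitt p 𝔽)).map ψ
    simp only [map_sum, map_pow] at hu'
    simp only [map_pow]
    refine IsNilpotent.isUnit_add_left_of_commute ?_ hu' (Commute.all _ _)
    exact (Commute.all _ _).isNilpotent_mul_right h
  · rw [thetaProd, Finset.prod_congr rfl fun i _ => hy _, hz]
    ring

/-- Translation by t gives Σ = Θ(t)Σ, hence πuΣ = 0 with u a unit. The factor π must stay, being
nilpotent in `S`. -/
theorem pi_mul_sum_thetaProd [Fintype 𝔽] (h : IsNilpotent (ψ (pi p 𝔽)))
    (hT : (T : PowerSeries S) = map ψ (theta p 𝔽)) {b : ℕ} (hb0 : b ≠ 0)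
    (hb : Nat.card 𝔽 = p ^ b) :
    ψ (pi p 𝔽) * ∑ t : 𝔽, thetaProd ψ T b t = 0 := by
  have hb' : ∀ t : 𝔽, t ^ p ^ b = t := by
    intro t
    rw [← hb, Nat.card_eq_fintype_card, FiniteField.pow_card]
  obtain ⟨t, u, hu, ht⟩ := exists_thetaProd_eq h hT hb0 hb
  have hsum : ∑ s : 𝔽, thetaProd ψ T b s = thetaProd ψ T b t * ∑ s : 𝔽, thetaProd ψ T b s := by
    conv_lhs => rw [← Equiv.sum_comp (Equiv.addLeft t)]
    rw [Finset.mul_sum]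
    exact Finset.sum_congr rfl fun s _ => thetaProd_add h hT hb' t s
  rw [ht] at hsum
  refine (hu.mul_right_eq_zero).1 ?_
  linear_combination -hsum

end Character

end DworkR

namespace DworkR

open PowerSeries

/-! ### Base change to a larger field -/

section BaseChange

variable (p : ℕ) [Fact p.Prime] {𝔽 E : Type*} [Field 𝔽] [Field E]

/-- The homomorphism between the rings `R` of two fields induced by a homomorphism between the
fields. -/
noncomputable def baseChange (g : 𝔽 →+* E) : DworkR p 𝔽 →+* DworkR p E :=
  AdjoinRoot.lift ((ofWitt p E).comp (WittVector.map g)) (pi p E) (by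
    rw [Polynomial.eval₂_add, Polynomial.eval₂_pow, Polynomial.eval₂_X, Polynomial.eval₂_C,
      map_natCast ((ofWitt p E).comp (WittVector.map g)), pi_pow, neg_add_cancel])

theorem baseChange_pi (g : 𝔽 →+* E) : baseChange p g (pi p 𝔽) = pi p E :=
  AdjoinRoot.lift_root _

theorem baseChange_ofWitt (g : 𝔽 →+* E) (w : WittVector p 𝔽) :
    baseChange p g (ofWitt p 𝔽 w) = ofWitt p E (WittVector.map g w) :=
  AdjoinRoot.lift_of _

theorem baseChange_teich (g : 𝔽 →+* E) (t : 𝔽) :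
    baseChange p g (teich p 𝔽 t) = teich p E (g t) := by
  change baseChange p g (ofWitt p 𝔽 _) = _
  rw [baseChange_ofWitt, WittVector.map_teichmuller]
  rfl

variable (E) in
/-- The residue homomorphism of `R`. -/
noncomputable def residue [CharP E p] : DworkR p E →+* E :=
  AdjoinRoot.lift WittVector.constantCoeff 0 (by
    rw [Polynomial.eval₂_add, Polynomial.eval₂_pow, Polynomial.eval₂_X, Polynomial.eval₂_C,
      map_natCast, CharP.cast_eq_zero, add_zero,
      zero_pow (Nat.sub_pos_of_lt (Fact.out : p.Prime).one_lt).ne'])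

theorem residue_pi [CharP E p] : residue p E (pi p E) = 0 :=
  AdjoinRoot.lift_root _

theorem residue_teich [CharP E p] (t : E) : residue p E (teich p E t) = t := by
  have h : residue p E (teich p E t) = WittVector.constantCoeff (WittVector.teichmuller p t) :=
    AdjoinRoot.lift_of _
  rw [h]
  exact WittVector.teichmuller_coeff_zero p t

theorem not_isUnit_pi [CharP E p] : ¬ IsUnit (pi p E) := fun h => by
  have := h.map (residue p E)
  rw [residue_pi] at this
  exact not_isUnit_zero this

theorem exists_eq_ofWitt_add (x : DworkR p 𝔽) : ∃ w y, x = ofWitt p 𝔽 w + pi p 𝔽 * y := by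
  obtain ⟨P, rfl⟩ := AdjoinRoot.mk_surjective x
  refine ⟨P.coeff 0, AdjoinRoot.mk _ P.divX, ?_⟩
  conv_lhs => rw [← Polynomial.divX_mul_X_add P]
  rw [map_add, map_mul, AdjoinRoot.mk_X, add_comm, mul_comm]
  rfl

variable [Finite 𝔽] [CharP 𝔽 p] [Finite E] [CharP E p]

theorem map_baseChange_theta (g : 𝔽 →+* E) :
    map (baseChange p g) (theta p 𝔽) = theta p E := by
  refine eq_of_derivative_eq_mul ?_ (logDerivative_theta p E) ?_
  · rw [derivative_map, logDerivative_theta]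
    simp [baseChange_pi]
  · rw [constantCoeff_theta]
    change baseChange p g (constantCoeff (theta p 𝔽)) = 1
    rw [constantCoeff_theta, map_one]

/-- Modulo π, x is a Witt vector w. If w has non-zero residue, its image is a unit and cannot be
divisible by π; otherwise p divides w, and π divides p. -/
theorem pi_dvd_of_pi_dvd_baseChange (g : 𝔽 →+* E) {x : DworkR p 𝔽}
    (h : pi p E ∣ baseChange p g x) : pi p 𝔽 ∣ x := by
  obtain ⟨w, y, rfl⟩ := exists_eq_ofWitt_add p x
  rw [map_add, map_mul, baseChange_pi, baseChange_ofWitt] at h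
  have h1 : pi p E ∣ ofWitt p E (WittVector.map g w) :=
    (dvd_add_left (dvd_mul_right _ _)).1 h
  by_cases hw : WittVector.constantCoeff w = 0
  · obtain ⟨v, rfl⟩ := exists_eq_natCast_mul p hw
    refine dvd_add ?_ (dvd_mul_right _ _)
    rw [map_mul, map_natCast (ofWitt p 𝔽), natCast_eq, neg_mul, dvd_neg]
    exact (dvd_pow_self _ (Nat.sub_pos_of_lt (Fact.out : p.Prime).one_lt).ne').mul_right _
  · have hu := (((WittVector.isUnit_of_coeff_zero_ne_zero w hw).map (WittVector.map g)).map
      (ofWitt p E))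
    exact absurd (isUnit_of_dvd_unit h1 hu) (not_isUnit_pi p)

theorem pi_pow_dvd_of_pi_pow_dvd_baseChange (g : 𝔽 →+* E) (m : ℕ) {x : DworkR p 𝔽}
    (h : pi p E ^ m ∣ baseChange p g x) : pi p 𝔽 ^ m ∣ x := by
  induction m generalizing x with
  | zero => simp
  | succ m ih =>
    obtain ⟨y, rfl⟩ := pi_dvd_of_pi_dvd_baseChange p g ((dvd_pow_self _ m.succ_ne_zero).trans h)
    rw [map_mul, baseChange_pi, pow_succ'] at h
    rw [pow_succ']
    exact mul_dvd_mul_left _ (ih ((mul_dvd_mul_iff_left (pi_ne_zero p E)).1 h))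

end BaseChange

/-! ### The order of τ -/

section Tau

variable (p : ℕ) [Fact p.Prime] {𝔽 : Type*} [Field 𝔽] [Finite 𝔽] [CharP 𝔽 p]

theorem coeff_frobenius_iterate (a : ℕ) (w : WittVector p 𝔽) (m : ℕ) :
    ((WittVector.frobenius : WittVector p 𝔽 →+* WittVector p 𝔽)^[a] w).coeff m =
      w.coeff m ^ p ^ a := by
  induction a with
  | zero => simp
  | succ a ih =>
    rw [Function.iterate_succ_apply', WittVector.coeff_frobenius_charP, ih, ← pow_mul, pow_succ]

theorem tau_iterate_eq {a : ℕ} (ha : ∀ t : 𝔽, t ^ p ^ a = t) (x : DworkR p 𝔽) :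
    (tau p 𝔽)^[a] x = x := by
  have hof (w : WittVector p 𝔽) (b : ℕ) : (tau p 𝔽)^[b] (AdjoinRoot.of _ w) =
      AdjoinRoot.of _ ((WittVector.frobenius : WittVector p 𝔽 →+* WittVector p 𝔽)^[b] w) := by
    induction b with
    | zero => rfl
    | succ b ih => rw [Function.iterate_succ_apply', ih, tau_of, Function.iterate_succ_apply']
  obtain ⟨P, rfl⟩ := AdjoinRoot.mk_surjective x
  induction P using Polynomial.induction_on with
  | C w =>
    rw [AdjoinRoot.mk_C, hof]
    congr 1
    ext m
    rw [coeff_frobenius_iterate, ha]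
  | add P Q hP hQ => rw [map_add, iterate_map_add, hP, hQ]
  | monomial m w ih =>
    rw [pow_succ, ← mul_assoc, map_mul, iterate_map_mul, ih, AdjoinRoot.mk_X]
    congr 1
    exact Function.iterate_fixed (tau_pi p 𝔽) a

theorem tau_symm_iterate_eq {a : ℕ} (ha : ∀ t : 𝔽, t ^ p ^ a = t) (x : DworkR p 𝔽) :
    (tau p 𝔽).symm^[a] x = x := by
  conv_lhs => rw [← tau_iterate_eq p ha x]
  exact (Function.LeftInverse.iterate (tau p 𝔽).symm_apply_apply a) x

end Tau

end DworkR

/-- The rule ψ(A(X^Q)·B) = A·ψ(B) in coefficients, where ψ keeps the exponents divisible by Q and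
divides them by Q. -/
theorem MvPowerSeries.coeff_smul_expand_mul {σ R : Type*} [CommRing R] [DecidableEq σ] (Q : ℕ)
    (hQ : Q ≠ 0) (A B : MvPowerSeries σ R) (r : σ →₀ ℕ) :
    MvPowerSeries.coeff (Q • r) (MvPowerSeries.expand Q hQ A * B) =
      ∑ x ∈ Finset.HasAntidiagonal.antidiagonal r,
        MvPowerSeries.coeff x.1 A * MvPowerSeries.coeff (Q • x.2) B := by
  rw [MvPowerSeries.coeff_mul]
  symm
  refine Finset.sum_of_injOn (fun x => (Q • x.1, Q • x.2)) ?_ ?_ ?_ ?_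
  · intro x _ y _ h
    have h' := Prod.ext_iff.1 h
    exact Prod.ext (nsmul_right_injective hQ h'.1) (nsmul_right_injective hQ h'.2)
  · intro x hx
    have := Finset.HasAntidiagonal.mem_antidiagonal.1 (Finset.mem_coe.1 hx)
    refine Finset.mem_coe.2 (Finset.HasAntidiagonal.mem_antidiagonal.2 ?_)
    rw [← smul_add, this]
  · intro y hy hny
    have hy' := Finset.HasAntidiagonal.mem_antidiagonal.1 hy
    by_cases h : ∀ i, Q ∣ y.1 i
    · refine absurd ?_ hny
      choose z hz using h
      have hfin : ∃ u : σ →₀ ℕ, y.1 = Q • u := by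
        refine ⟨y.1.mapRange (· / Q) (Nat.zero_div Q), ?_⟩
        ext i
        rw [Finsupp.smul_apply, Finsupp.mapRange_apply, smul_eq_mul, hz i,
          Nat.mul_div_cancel_left _ (Nat.pos_of_ne_zero hQ)]
      obtain ⟨u, hu⟩ := hfin
      have hle : u ≤ r := by
        intro i
        have h1 : Q * u i + y.2 i = Q * r i := by
          have := DFunLike.congr_fun hy' i
          rw [hu] at this
          simpa using this
        exact Nat.le_of_mul_le_mul_left (by omega : Q * u i ≤ Q * r i) (Nat.pos_of_ne_zero hQ)
      refine ⟨(u, r - u), Finset.mem_coe.2 (Finset.HasAntidiagonal.mem_antidiagonal.2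
        (add_tsub_cancel_of_le hle)), Prod.ext hu.symm ?_⟩
      refine add_left_cancel (a := y.1) ?_
      rw [hy', hu, ← smul_add, add_tsub_cancel_of_le hle]
    · push Not at h
      obtain ⟨i, hi⟩ := h
      rw [MvPowerSeries.coeff_expand_of_not_dvd Q hQ A hi, zero_mul]
  · intro x _
    rw [MvPowerSeries.coeff_expand_smul]

namespace Dwork

/-! ### Powers of the matrix and their diagonal -/

section Matrix

variable (p : ℕ) [Fact p.Prime] {𝔽 : Type*} [Field 𝔽] [Finite 𝔽] [CharP 𝔽 p] {n : ℕ}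

theorem mem_latticePoints_of_smul_mem {δ : Set (Fin n → ℝ)} {m : ℕ} (hm : m ≠ 0)
    {r : Fin (n + 1) →₀ ℕ} (h : m • r ∈ latticePoints δ) : r ∈ latticePoints δ := by
  have hm' : (m : ℝ) ≠ 0 := by exact_mod_cast hm
  have h2 := smul_mem_cone δ (inv_nonneg.2 (Nat.cast_nonneg m)) h
  have h3 : ((m : ℝ)⁻¹ • fun i => (((m • r) i : ℕ) : ℝ)) = fun i => (r i : ℝ) := by
    ext i
    simp [hm']
  rw [h3] at h2
  exact h2

theorem coeff_alpha {a : ℕ} (ha : ∀ t : 𝔽, t ^ p ^ a = t) (f : MvPolynomial (Fin n) 𝔽)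
    (A : MvPowerSeries (Fin (n + 1)) (DworkR p 𝔽)) (r : Fin (n + 1) →₀ ℕ) :
    MvPowerSeries.coeff r (alpha p a f A) = MvPowerSeries.coeff (p ^ a • r) (Fpow p a f * A) := by
  rw [alpha, psi_iterate_apply, DworkR.tau_symm_iterate_eq p ha]

theorem Ma_apply {a : ℕ} (ha : ∀ t : 𝔽, t ^ p ^ a = t) (f : MvPolynomial (Fin n) 𝔽)
    {δ : Set (Fin n → ℝ)} (hδ : IsAdmissible f δ) (u v : latticePoints δ) :
    Ma p a f hδ u v = MvPowerSeries.coeff (p ^ a • (u : Fin (n + 1) →₀ ℕ))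
      (Fpow p a f * MvPowerSeries.monomial (v : Fin (n + 1) →₀ ℕ) 1) :=
  coeff_alpha p ha f _ _

theorem ne_zero_of_mem_support_X0mul {f : MvPolynomial (Fin n) 𝔽} {j : Fin (n + 1) →₀ ℕ}
    (hj : j ∈ (X0mul f).support) : j ≠ 0 := by
  classical
  rw [X0mul, MvPolynomial.support_X_mul, Finset.mem_map] at hj
  obtain ⟨i, _, rfl⟩ := hj
  intro h
  have := DFunLike.congr_fun h 0
  simp at this

theorem hasSubst_monomial_pow {j : Fin (n + 1) →₀ ℕ} (hj : j ≠ 0) (c : DworkR p 𝔽) (s : ℕ) :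
    PowerSeries.HasSubst (MvPowerSeries.monomial j c ^ p ^ s) := by
  rw [MvPowerSeries.monomial_pow]
  exact PowerSeries.HasSubst.monomial
    (smul_ne_zero (pow_ne_zero _ (Fact.out : p.Prime).ne_zero) hj) _

theorem Fpow_zero (f : MvPolynomial (Fin n) 𝔽) : Fpow p 0 f = 1 := by
  simp [Fpow]

/-- Teichmüller coefficients are fixed by the p^b-th power, so (a_j X^j)^(p^b) is the monomial a_j
X^j with X replaced by X^(p^b). The factors with s ≥ b are thus those of `F^(a)` expanded. -/
theorem Fpow_add {b : ℕ} (hb : ∀ t : 𝔽, t ^ p ^ b = t) (a : ℕ) (f : MvPolynomial (Fin n) 𝔽) :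
    Fpow p (b + a) f = MvPowerSeries.expand (p ^ b)
      (pow_ne_zero _ (Fact.out : p.Prime).ne_zero) (Fpow p a f) * Fpow p b f := by
  rw [Fpow, Fpow, Fpow, map_prod, ← Finset.prod_mul_distrib]
  refine Finset.prod_congr rfl fun j hj => ?_
  rw [Finset.prod_range_add, mul_comm, map_prod]
  congr 1
  refine Finset.prod_congr rfl fun s _ => ?_
  rw [PowerSeries.expand_subst _ _
    (hasSubst_monomial_pow p (ne_zero_of_mem_support_X0mul hj) _ s), map_pow,
    MvPowerSeries.expand_monomial, pow_add, pow_mul, MvPowerSeries.monomial_pow,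
    ← DworkR.teich_pow, hb]

theorem pow_mul_eq_self {a : ℕ} (ha : ∀ t : 𝔽, t ^ p ^ a = t) (k : ℕ) (t : 𝔽) :
    t ^ p ^ (a * k) = t := by
  induction k with
  | zero => simp
  | succ k ih => rw [Nat.mul_succ, pow_add, pow_mul, ih, ha]

/-- Composing the operators of `F^(a)` and `F^(ak)` gives that of `F^(ak+a)`, by `Fpow_add` and the
substitution rule for ψ. -/
theorem matPow_Ma_apply {a : ℕ} (ha : ∀ t : 𝔽, t ^ p ^ a = t) (f : MvPolynomial (Fin n) 𝔽)
    {δ : Set (Fin n → ℝ)} (hδ : IsAdmissible f δ) [DecidableEq (latticePoints δ)] (k : ℕ)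
    (u v : latticePoints δ) :
    matPow (Ma p a f hδ) k u v = MvPowerSeries.coeff (p ^ (a * k) • (u : Fin (n + 1) →₀ ℕ))
      (Fpow p (a * k) f * MvPowerSeries.monomial (v : Fin (n + 1) →₀ ℕ) 1) := by
  classical
  have hp : p.Prime := Fact.out
  induction k generalizing u v with
  | zero =>
    rw [mul_zero, Fpow_zero, one_mul, pow_zero, one_smul, MvPowerSeries.coeff_monomial]
    simp only [matPow, Matrix.one_apply, Subtype.ext_iff]
  | succ k ih =>
    rw [Nat.mul_succ, Fpow_add p (pow_mul_eq_self p ha k), mul_assoc, pow_add, mul_smul,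
      MvPowerSeries.coeff_smul_expand_mul]
    simp only [matPow]
    have hsupp : (Function.support fun w => Ma p a f hδ u w * matPow (Ma p a f hδ) k w v) ⊆
        (Finset.subtype (· ∈ latticePoints δ)
          (Finset.Iic (p ^ a • (u : Fin (n + 1) →₀ ℕ))) : Set (latticePoints δ)) := by
      intro w hw
      rw [Finset.mem_coe, Finset.mem_subtype, Finset.mem_Iic]
      by_contra hle
      apply hw
      simp only [Ma_apply p ha]
      rw [MvPowerSeries.coeff_mul_monomial, if_neg hle, zero_mul]
    rw [finsum_eq_sum_of_support_subset _ hsupp]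
    -- The intermediate index w is the second member of an antidiagonal pair. Pairs whose second
    -- member lies outside the cone contribute zero, because `F^(ak)` times X^v lies in L_Δ.
    refine Finset.sum_of_injOn
      (fun w => (p ^ a • (u : Fin (n + 1) →₀ ℕ) - (w : Fin (n + 1) →₀ ℕ), (w : Fin (n + 1) →₀ ℕ)))
      ?_ ?_ ?_ ?_
    · intro w _ w' _ h
      exact Subtype.ext (Prod.ext_iff.1 h).2
    · intro w hw
      rw [Finset.mem_coe, Finset.mem_subtype, Finset.mem_Iic] at hw
      exact Finset.mem_coe.2 (Finset.HasAntidiagonal.mem_antidiagonal.2 (tsub_add_cancel_of_le hw))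
    · intro y hy hny
      have hy' := Finset.HasAntidiagonal.mem_antidiagonal.1 hy
      by_contra hne
      have hmem := mul_mem (Fpow_mem_LDelta p (a * k) hδ.newton_subset)
        (monomial_mem_LDelta p δ v.2 1) _ (right_ne_zero_of_mul hne)
      have hmem' := mem_latticePoints_of_smul_mem (pow_ne_zero _ hp.ne_zero) hmem
      refine hny ⟨⟨y.2, hmem'⟩, ?_, Prod.ext ?_ rfl⟩
      · rw [Finset.mem_coe, Finset.mem_subtype, Finset.mem_Iic, ← hy']
        exact le_add_self
      · exact tsub_eq_of_eq_add hy'.symm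
    · intro w hw
      rw [Finset.mem_subtype, Finset.mem_Iic] at hw
      rw [ih, Ma_apply p ha, MvPowerSeries.coeff_mul_monomial, if_pos hw, mul_one]

theorem matPow_Ma_diag {a : ℕ} (ha : ∀ t : 𝔽, t ^ p ^ a = t) (f : MvPolynomial (Fin n) 𝔽)
    {δ : Set (Fin n → ℝ)} (hδ : IsAdmissible f δ) [DecidableEq (latticePoints δ)] (k : ℕ)
    (u : latticePoints δ) :
    matPow (Ma p a f hδ) k u u =
      MvPowerSeries.coeff ((p ^ (a * k) - 1) • (u : Fin (n + 1) →₀ ℕ)) (Fpow p (a * k) f) := by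
  have hpos : 1 ≤ p ^ (a * k) := Nat.one_le_pow _ _ (Fact.out : p.Prime).pos
  have h : p ^ (a * k) • (u : Fin (n + 1) →₀ ℕ) = (p ^ (a * k) - 1) • (u : Fin (n + 1) →₀ ℕ) + u := by
    rw [← succ_nsmul, Nat.sub_add_cancel hpos]
  rw [matPow_Ma_apply p ha, h, MvPowerSeries.coeff_add_mul_monomial, mul_one]

end Matrix

end Dwork

namespace Dwork

/-! ### Character sums over the torus -/

section CharacterSum

variable (p : ℕ) [Fact p.Prime] {E : Type*} [Field E] [Fintype E] [CharP E p]

/-- Orthogonality for the character y ↦ teich(y)^m of the cyclic group Eˣ. It is trivial exactly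
when y^m = 1 for all y, since the residue map inverts Teichmüller lifting. -/
theorem sum_units_teich_pow [DecidableEq E] (m : ℕ) :
    ∑ y : Eˣ, DworkR.teich p E (y : E) ^ m =
      if Fintype.card E - 1 ∣ m then ((Fintype.card E - 1 : ℕ) : DworkR p E) else 0 := by
  classical
  let φ : Eˣ →* DworkR p E :=
    { toFun := fun y => DworkR.teich p E (y : E) ^ m
      map_one' := by rw [Units.val_one, DworkR.teich_one, one_pow]
      map_mul' := fun x y => by rw [Units.val_mul, DworkR.teich_mul, mul_pow] }
  have hφ : φ = 1 ↔ Fintype.card E - 1 ∣ m := by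
    rw [← FiniteField.forall_pow_eq_one_iff E m, DFunLike.ext_iff]
    refine forall_congr' fun y => ⟨fun h => ?_, fun h => ?_⟩
    · have h1 : DworkR.teich p E (y : E) ^ m = 1 := h
      rw [← DworkR.teich_pow] at h1
      have h2 := congrArg (DworkR.residue p E) h1
      rw [DworkR.residue_teich, map_one] at h2
      exact Units.ext (by rw [Units.val_pow_eq_pow_val, h2, Units.val_one])
    · change DworkR.teich p E (y : E) ^ m = 1
      rw [← DworkR.teich_pow, ← Units.val_pow_eq_pow_val, h, Units.val_one, DworkR.teich_one]
  have h := sum_hom_units φ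
  rw [Fintype.card_units] at h
  change ∑ y : Eˣ, φ y = _
  rw [h]
  simp only [hφ]
  split_ifs <;> simp

theorem sum_prod_teich_pow [DecidableEq E] {ι : Type*} [Fintype ι] [DecidableEq ι] (r : ι → ℕ) :
    ∑ x : ι → Eˣ, ∏ i, DworkR.teich p E (x i : E) ^ r i =
      if ∀ i, Fintype.card E - 1 ∣ r i then
        ((Fintype.card E - 1 : ℕ) : DworkR p E) ^ Fintype.card ι else 0 := by
  have h := Finset.prod_univ_sum (fun _ : ι => (Finset.univ : Finset Eˣ))
    (fun i y => DworkR.teich p E (y : E) ^ r i)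
  rw [Fintype.piFinset_univ] at h
  rw [← h]
  simp only [sum_units_teich_pow]
  split_ifs with hr
  · rw [Finset.prod_congr rfl fun i _ => if_pos (hr i), Finset.prod_const, Finset.card_univ]
  · push Not at hr
    obtain ⟨i, hi⟩ := hr
    exact Finset.prod_eq_zero (Finset.mem_univ i) (if_neg hi)

theorem sum_units_add {M : Type*} [AddCommMonoid M] [DecidableEq E] (h : E → M) :
    ∑ y : Eˣ, h y + h 0 = ∑ y : E, h y := by
  rw [← Finset.sum_erase_add _ _ (Finset.mem_univ (0 : E))]
  congr 1
  refine Finset.sum_bij (fun y _ => (y : E)) (fun y _ => ?_) (fun x _ y _ hxy => Units.ext hxy)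
    (fun y hy => ?_) (fun _ _ => rfl)
  · exact Finset.mem_erase.2 ⟨y.ne_zero, Finset.mem_univ _⟩
  · exact ⟨Units.mk0 y (Finset.ne_of_mem_erase hy), Finset.mem_univ _, rfl⟩

variable {S : Type*} [CommRing S]

/-- The sum over a torus of an additive character with vanishing sum, evaluated at the values of
a multiple `x₀ h(x)` of a function. -/
theorem mul_sum_units_prod [DecidableEq E] {Y : Type*} [Fintype Y] {Θ : E → S} (h0 : Θ 0 = 1)
    {c : S} (hΘ : c * ∑ t : E, Θ t = 0) (h : Y → E) :
    c * ∑ z : Eˣ × Y, Θ (z.1 * h z.2) = c * ((Fintype.card E : S) * Nat.card {y // h y = 0} -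
      Fintype.card Y) := by
  classical
  -- Where h(y) = 0 every term is 1 and the sum is |E| - 1. Elsewhere multiplication by h(y)
  -- permutes Eˣ, and the sum over E less Θ(0) gives -1, up to the factor c.
  have hone (y : Y) : c * ∑ z : Eˣ, Θ (z * h y) =
      c * (if h y = 0 then (Fintype.card E : S) else 0) - c := by
    by_cases hy : h y = 0
    · simp only [hy, mul_zero, h0, if_true, Finset.sum_const, Finset.card_univ, Fintype.card_units]
      rw [nsmul_eq_mul, mul_one, Nat.cast_sub Fintype.card_pos]
      push_cast
      ring
    · rw [if_neg hy]
      have h1 : ∑ z : Eˣ, Θ (z * h y) = ∑ z : Eˣ, Θ z :=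
        Fintype.sum_equiv (Equiv.mulRight (Units.mk0 _ hy)) _ _ fun z => by simp
      have h2 := sum_units_add Θ
      rw [h0] at h2
      rw [h1]
      linear_combination c * h2 + hΘ
  rw [Fintype.sum_prod_type_right, Finset.mul_sum, Finset.sum_congr rfl fun y _ => hone y,
    Finset.sum_sub_distrib, ← Finset.mul_sum, Finset.sum_ite, Finset.sum_const_zero, add_zero,
    Finset.sum_const, Finset.sum_const, Finset.card_univ, Nat.card_eq_fintype_card,
    Fintype.card_subtype]
  simp only [nsmul_eq_mul]
  ring

end CharacterSum

/-! ### Values of F^(b) at Teichmüller points -/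

section Evaluation

variable {p : ℕ} [Fact p.Prime] {𝔽 E : Type*} [Field 𝔽] [Finite 𝔽] [CharP 𝔽 p]
  [Field E] [Finite E] [CharP E p] {n : ℕ} {S : Type*} [CommRing S]

/-- A polynomial which represents the image of `F^(b)` over a ring in which `π` is nilpotent. -/
noncomputable def FpowPoly (χ : DworkR p 𝔽 →+* S) (T : Polynomial S) (b : ℕ)
    (f : MvPolynomial (Fin n) 𝔽) : MvPolynomial (Fin (n + 1)) S :=
  ∏ j ∈ (X0mul f).support, ∏ s ∈ Finset.range b,
    Polynomial.aeval
      (MvPolynomial.monomial j (χ (DworkR.teich p 𝔽 ((X0mul f).coeff j))) ^ p ^ s) T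

theorem coe_aeval_eq_subst {σ : Type*} (T : Polynomial S) (m : MvPolynomial σ S)
    (hm : PowerSeries.HasSubst (m : MvPowerSeries σ S)) :
    ((Polynomial.aeval m T : MvPolynomial σ S) : MvPowerSeries σ S) =
      (T : PowerSeries S).subst (m : MvPowerSeries σ S) := by
  rw [PowerSeries.subst_coe hm, Polynomial.aeval_def, Polynomial.aeval_def]
  have h := Polynomial.hom_eval₂ T (algebraMap S (MvPolynomial σ S))
    (MvPolynomial.coeToMvPowerSeries.ringHom (σ := σ) (R := S)) m
  rw [MvPolynomial.coeToMvPowerSeries.ringHom_apply] at h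
  rw [h]
  congr 1
  ext r : 1
  exact MvPolynomial.coe_C r

theorem coe_FpowPoly {χ : DworkR p 𝔽 →+* S} {T : Polynomial S}
    (hT : (T : PowerSeries S) = PowerSeries.map χ (DworkR.theta p 𝔽)) (b : ℕ)
    (f : MvPolynomial (Fin n) 𝔽) :
    (FpowPoly χ T b f : MvPowerSeries (Fin (n + 1)) S) = MvPowerSeries.map χ (Fpow p b f) := by
  rw [FpowPoly, Fpow, map_prod, ← MvPolynomial.coeToMvPowerSeries.ringHom_apply, map_prod]
  refine Finset.prod_congr rfl fun j hj => ?_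
  rw [map_prod, map_prod]
  refine Finset.prod_congr rfl fun s _ => ?_
  have hsub := hasSubst_monomial_pow p (ne_zero_of_mem_support_X0mul hj)
    (DworkR.teich p 𝔽 ((X0mul f).coeff j)) s
  have he : ((MvPolynomial.monomial j (χ (DworkR.teich p 𝔽 ((X0mul f).coeff j))) ^ p ^ s :
      MvPolynomial (Fin (n + 1)) S) : MvPowerSeries (Fin (n + 1)) S) =
      MvPowerSeries.map χ
        (MvPowerSeries.monomial j (DworkR.teich p 𝔽 ((X0mul f).coeff j)) ^ p ^ s) := by
    rw [MvPolynomial.coe_pow, MvPolynomial.coe_monomial, map_pow, MvPowerSeries.map_monomial]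
  have hsub' : PowerSeries.HasSubst (MvPowerSeries.map χ
        (MvPowerSeries.monomial j (DworkR.teich p 𝔽 ((X0mul f).coeff j)) ^ p ^ s)) := by
    rw [map_pow, MvPowerSeries.map_monomial, MvPowerSeries.monomial_pow]
    exact PowerSeries.HasSubst.monomial
      (smul_ne_zero (pow_ne_zero _ (Fact.out : p.Prime).ne_zero)
        (ne_zero_of_mem_support_X0mul hj)) _
  rw [MvPolynomial.coeToMvPowerSeries.ringHom_apply, coe_aeval_eq_subst _ _ (he ▸ hsub'), he, hT]
  exact (PowerSeries.map_subst hsub _).symm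

theorem thetaProd_sum {ψ : DworkR p E →+* S} (h : IsNilpotent (ψ (DworkR.pi p E)))
    {T : Polynomial S} (hT : (T : PowerSeries S) = PowerSeries.map ψ (DworkR.theta p E)) {b : ℕ}
    (hb : ∀ t : E, t ^ p ^ b = t) {ι : Type*} (s : Finset ι) (y : ι → E) :
    DworkR.thetaProd ψ T b (∑ i ∈ s, y i) = ∏ i ∈ s, DworkR.thetaProd ψ T b (y i) := by
  classical
  induction s using Finset.induction_on with
  | empty => simp [DworkR.thetaProd_zero hT]
  | insert i s hi ih =>
    rw [Finset.sum_insert hi, Finset.prod_insert hi, DworkR.thetaProd_add h hT hb, ih]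

/-- The factors attached to one monomial multiply to Θ of the value of that term of X₀f; additivity
of Θ then turns the product over monomials into Θ of the sum. -/
theorem eval_FpowPoly {ψ : DworkR p E →+* S} (h : IsNilpotent (ψ (DworkR.pi p E)))
    {T : Polynomial S} (hT : (T : PowerSeries S) = PowerSeries.map ψ (DworkR.theta p E)) {b : ℕ}
    (hb : ∀ t : E, t ^ p ^ b = t) (g : 𝔽 →+* E) (f : MvPolynomial (Fin n) 𝔽)
    (x : Fin (n + 1) → E) :
    MvPolynomial.eval (fun i => ψ (DworkR.teich p E (x i)))
      (FpowPoly (ψ.comp (DworkR.baseChange p g)) T b f) =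
      DworkR.thetaProd ψ T b (MvPolynomial.eval₂ g x (X0mul f)) := by
  rw [MvPolynomial.eval₂_eq', thetaProd_sum h hT hb, FpowPoly, map_prod]
  refine Finset.prod_congr rfl fun j _ => ?_
  rw [map_prod, DworkR.thetaProd]
  refine Finset.prod_congr rfl fun s _ => ?_
  have hteich : ψ (DworkR.teich p E (g ((X0mul f).coeff j) * ∏ i, x i ^ j i)) =
      ψ (DworkR.teich p E (g ((X0mul f).coeff j))) * ∏ i, ψ (DworkR.teich p E (x i)) ^ j i := by
    have hprod (s : Finset (Fin (n + 1))) : DworkR.teich p E (∏ i ∈ s, x i ^ j i) =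
        ∏ i ∈ s, DworkR.teich p E (x i) ^ j i := by
      classical
      induction s using Finset.induction_on with
      | empty => simp [DworkR.teich_one]
      | insert i s hi ih =>
        rw [Finset.prod_insert hi, Finset.prod_insert hi, DworkR.teich_mul, DworkR.teich_pow, ih]
    rw [DworkR.teich_mul, hprod, map_mul, map_prod]
    simp only [map_pow]
  rw [map_pow, hteich, RingHom.comp_apply, DworkR.baseChange_teich, Polynomial.aeval_def,
    Polynomial.hom_eval₂, map_pow, MvPolynomial.eval_monomial, Finsupp.prod_fintype _ _ (by simp)]
  have hC : (MvPolynomial.eval fun i => ψ (DworkR.teich p E (x i))).comp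
      (algebraMap S (MvPolynomial (Fin (n + 1)) S)) = RingHom.id S := by
    ext r
    exact MvPolynomial.eval_C r
  rw [hC, Polynomial.eval₂_id]

end Evaluation

end Dwork

namespace Dwork

/-! ### The trace formula modulo powers of π -/

section Trace

variable {p : ℕ} [Fact p.Prime] {𝔽 E : Type*} [Field 𝔽] [Finite 𝔽] [CharP 𝔽 p]
  [Field E] [Fintype E] [CharP E p] [Algebra 𝔽 E] {n : ℕ} {S : Type*} [CommRing S]

theorem eval₂_X0mul (f : MvPolynomial (Fin n) 𝔽) (x : Fin (n + 1) → E) :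
    MvPolynomial.eval₂ (algebraMap 𝔽 E) x (X0mul f) =
      x 0 * MvPolynomial.aeval (fun i => x i.succ) f := by
  rw [X0mul, MvPolynomial.eval₂_mul, MvPolynomial.eval₂_X, MvPolynomial.eval₂_rename]
  rfl

theorem pi_mul_sum_eval_FpowPoly [DecidableEq E] {ψ : DworkR p E →+* S}
    (h : IsNilpotent (ψ (DworkR.pi p E)))
    {T : Polynomial S} (hT : (T : PowerSeries S) = PowerSeries.map ψ (DworkR.theta p E)) {b : ℕ}
    (hb0 : b ≠ 0) (hb : Fintype.card E = p ^ b) (f : MvPolynomial (Fin n) 𝔽) :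
    ψ (DworkR.pi p E) * ∑ x : Fin (n + 1) → Eˣ,
      MvPolynomial.eval (fun i => ψ (DworkR.teich p E (x i)))
        (FpowPoly (ψ.comp (DworkR.baseChange p (algebraMap 𝔽 E))) T b f) =
    ψ (DworkR.pi p E) * ((p ^ b : ℕ) * torusZeros f E - (p ^ b - 1 : ℕ) ^ n) := by
  classical
  have hb' : ∀ t : E, t ^ p ^ b = t := fun t => by rw [← hb, FiniteField.pow_card]
  have hΘ := DworkR.pi_mul_sum_thetaProd h hT hb0 (by rw [Nat.card_eq_fintype_card, hb])
  have h1 := mul_sum_units_prod (Y := Fin n → Eˣ) (DworkR.thetaProd_zero hT b) hΘ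
    (fun y => MvPolynomial.aeval (fun i => (y i : E)) f)
  have hcard : (Fintype.card (Fin n → Eˣ) : S) = (p ^ b - 1 : ℕ) ^ n := by
    rw [Fintype.card_fun, Fintype.card_fin, Fintype.card_units, hb, Nat.cast_pow]
  rw [hcard, hb] at h1
  rw [torusZeros, ← h1]
  congr 1
  refine (Fintype.sum_equiv (Fin.consEquiv fun _ : Fin (n + 1) => Eˣ) _ _ fun z => ?_).symm
  rw [eval_FpowPoly h hT hb', eval₂_X0mul]
  rfl

theorem sum_eval_teich [DecidableEq E] {ψ : DworkR p E →+* S} (P : MvPolynomial (Fin (n + 1)) S) :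
    ∑ x : Fin (n + 1) → Eˣ, MvPolynomial.eval (fun i => ψ (DworkR.teich p E (x i))) P =
      (Fintype.card E - 1 : ℕ) ^ (n + 1) *
        ∑ r ∈ P.support with ∀ i, Fintype.card E - 1 ∣ r i, P.coeff r := by
  classical
  simp only [MvPolynomial.eval_eq']
  rw [Finset.sum_comm, Finset.mul_sum, Finset.sum_filter]
  refine Finset.sum_congr rfl fun r _ => ?_
  have h := congrArg ψ (sum_prod_teich_pow p (E := E) (fun i => r i))
  rw [map_sum] at h
  simp only [map_prod, map_pow] at h
  rw [← Finset.mul_sum, h, Fintype.card_fin]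
  split_ifs
  · rw [map_pow, map_natCast, mul_comm]
  · rw [map_zero, mul_zero]

/-- The cone is stable under division by m, so every exponent in the support divisible by m is m
times a lattice point of the cone. -/
theorem sum_coeff_smul_eq {δ : Set (Fin n → ℝ)} {m : ℕ} (hm : m ≠ 0)
    {P : MvPolynomial (Fin (n + 1)) S} (hP : ∀ r ∈ P.support, r ∈ latticePoints δ)
    {U : Finset (latticePoints δ)}
    (hU : ∀ u : latticePoints δ, m • (u : Fin (n + 1) →₀ ℕ) ∈ P.support → u ∈ U) :
    ∑ u ∈ U, P.coeff (m • (u : Fin (n + 1) →₀ ℕ)) =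
      ∑ r ∈ P.support with ∀ i, m ∣ r i, P.coeff r := by
  classical
  rw [← Finset.sum_filter_of_ne (p := fun u : latticePoints δ =>
    m • (u : Fin (n + 1) →₀ ℕ) ∈ P.support) (fun u _ hu => MvPolynomial.mem_support_iff.2 hu)]
  refine Finset.sum_bij (fun u _ => m • (u : Fin (n + 1) →₀ ℕ)) (fun u hu => ?_)
    (fun u _ v _ huv => Subtype.ext (nsmul_right_injective hm huv)) (fun r hr => ?_)
    (fun _ _ => rfl)
  · rw [Finset.mem_filter] at hu ⊢
    exact ⟨hu.2, fun i => by simp⟩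
  · rw [Finset.mem_filter] at hr
    have hr' : m • r.mapRange (· / m) (Nat.zero_div m) = r := by
      ext i
      simp [Nat.mul_div_cancel' (hr.2 i)]
    have hmem := hP r hr.1
    rw [← hr'] at hmem
    have hsupp : m • r.mapRange (· / m) (Nat.zero_div m) ∈ P.support := hr'.symm ▸ hr.1
    have hmem' := mem_latticePoints_of_smul_mem hm hmem
    exact ⟨⟨_, hmem'⟩, Finset.mem_filter.2 ⟨hU ⟨_, hmem'⟩ hsupp, hsupp⟩, hr'⟩

theorem finite_setOf_smul_mem {δ : Set (Fin n → ℝ)} {m : ℕ} (hm : m ≠ 0)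
    (s : Finset (Fin (n + 1) →₀ ℕ)) :
    {u : latticePoints δ | m • (u : Fin (n + 1) →₀ ℕ) ∈ s}.Finite :=
  s.finite_toSet.preimage fun _ _ _ _ h => Subtype.ext (nsmul_right_injective hm h)

variable (E) in
/-- The partial sums of the diagonal of the matrix satisfy the trace formula modulo powers
of `π`. -/
theorem exists_finset_pi_pow_dvd {a k : ℕ} (ha : ∀ t : 𝔽, t ^ p ^ a = t) (hb0 : a * k ≠ 0)
    (hb : Fintype.card E = p ^ (a * k)) (f : MvPolynomial (Fin n) 𝔽) {δ : Set (Fin n → ℝ)}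
    (hδ : IsAdmissible f δ) [DecidableEq (latticePoints δ)] (M : ℕ) :
    ∃ U₀ : Finset (latticePoints δ), ∀ U, U₀ ⊆ U → DworkR.pi p 𝔽 ^ M ∣
      ((p ^ (a * k) - 1 : ℕ) : DworkR p 𝔽) ^ (n + 1) * ∑ u ∈ U, matPow (Ma p a f hδ) k u u -
        ((p ^ (a * k) : ℕ) * torusZeros f E - (p ^ (a * k) - 1 : ℕ) ^ n) := by
  classical
  -- The exponent is M + 1 because the character sum is known only after multiplication by π, which
  -- is cancelled at the end in the domain `R_E`.
  set ψ := Ideal.Quotient.mk (Ideal.span {DworkR.pi p E ^ (M + 1)}) with hψ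
  set g := algebraMap 𝔽 E
  set χ := ψ.comp (DworkR.baseChange p g) with hχ
  have hnil : IsNilpotent (ψ (DworkR.pi p E)) := ⟨M + 1, by
    rw [← map_pow]
    exact Ideal.Quotient.eq_zero_iff_mem.2 (Ideal.mem_span_singleton_self _)⟩
  obtain ⟨T, hT⟩ := DworkR.exists_polynomial_theta ψ hnil
  have hT' : (T : PowerSeries _) = PowerSeries.map χ (DworkR.theta p 𝔽) := by
    rw [hT, ← DworkR.map_baseChange_theta p g, hχ, PowerSeries.map_comp]
    rfl
  set P := FpowPoly χ T (a * k) f with hPdef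
  have hcoeff (r : Fin (n + 1) →₀ ℕ) :
      P.coeff r = χ (MvPowerSeries.coeff r (Fpow p (a * k) f)) := by
    rw [← MvPolynomial.coeff_coe, hPdef, coe_FpowPoly hT', MvPowerSeries.coeff_map]
  have hP : ∀ r ∈ P.support, r ∈ latticePoints δ := by
    intro r hr
    refine Fpow_mem_LDelta p (a * k) hδ.newton_subset r fun h => ?_
    rw [MvPolynomial.mem_support_iff, hcoeff, h, map_zero] at hr
    exact hr rfl
  have hm : p ^ (a * k) - 1 ≠ 0 :=
    (Nat.sub_pos_of_lt (Nat.one_lt_pow hb0 (Fact.out : p.Prime).one_lt)).ne'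
  -- Outside this finite set the diagonal entries map to zero in the quotient, so enlarging it does
  -- not change the sum there.
  refine ⟨(finite_setOf_smul_mem hm P.support).toFinset, fun U hU => ?_⟩
  have hsum := sum_coeff_smul_eq hm hP (U := U) fun u hu => hU (by simpa using hu)
  have h1 := sum_eval_teich (ψ := ψ) P
  rw [hb, ← hsum] at h1
  have h2 := pi_mul_sum_eval_FpowPoly hnil hT hb0 hb f
  rw [h1] at h2
  refine DworkR.pi_pow_dvd_of_pi_pow_dvd_baseChange p g M ?_
  refine (mul_dvd_mul_iff_left (DworkR.pi_ne_zero p E)).1 ?_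
  rw [← pow_succ', ← Ideal.mem_span_singleton, ← Ideal.Quotient.eq_zero_iff_mem]
  change ψ _ = 0
  have hdiag : ψ (DworkR.baseChange p g (∑ u ∈ U, matPow (Ma p a f hδ) k u u)) =
      ∑ u ∈ U, P.coeff ((p ^ (a * k) - 1) • (u : Fin (n + 1) →₀ ℕ)) := by
    rw [map_sum, map_sum]
    refine Finset.sum_congr rfl fun u _ => ?_
    rw [matPow_Ma_diag p ha, hcoeff]
    rfl
  simp only [map_sub, map_mul, map_pow, map_natCast] at h2 ⊢
  rw [hdiag]
  linear_combination h2

end Trace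

end Dwork

theorem DworkR.hasSum_of_dvd {p : ℕ} [Fact p.Prime] {𝔽 : Type*} [CommRing 𝔽] {ι : Type*}
    {D : ι → DworkR p 𝔽} {t : DworkR p 𝔽}
    (h : ∀ N : ℕ, ∃ U₀ : Finset ι, ∀ U, U₀ ⊆ U → (p : DworkR p 𝔽) ^ N ∣ ∑ u ∈ U, D u - t) :
    HasSum D t := by
  rw [HasSum, SummationFilter.unconditional_filter,
    (Ideal.hasBasis_nhds_adic (Ideal.span {(p : DworkR p 𝔽)}) t).tendsto_right_iff]
  intro N _
  obtain ⟨U₀, hU₀⟩ := h N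
  filter_upwards [Filter.eventually_ge_atTop U₀] with U hU
  refine ⟨∑ u ∈ U, D u - t, ?_, by simp⟩
  rw [SetLike.mem_coe, Ideal.span_singleton_pow, Ideal.mem_span_singleton]
  exact hU₀ U hU

theorem mainTheorem5 (p : ℕ) [Fact p.Prime] (a : ℕ)
    (𝔽 : Type*) [Field 𝔽] [Fintype 𝔽] [CharP 𝔽 p] (hq : Fintype.card 𝔽 = p ^ a)
    (n : ℕ) (f : MvPolynomial (Fin n) 𝔽)
    (δ : Set (Fin n → ℝ)) (hδ : Dwork.IsAdmissible f δ)
    (k : ℕ) (hk : 1 ≤ k)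
    (E : Type*) [Field E] [Fintype E] [Algebra 𝔽 E] (hE : Fintype.card E = (p ^ a) ^ k) :
    ∃ t : DworkR p 𝔽, Dwork.HasTrace (Dwork.matPow (Dwork.Ma p a f hδ) k) t ∧
      (((p : DworkR p 𝔽) ^ a) ^ k - 1) ^ (n + 1) * t =
        ((p : DworkR p 𝔽) ^ a) ^ k * (Dwork.torusZeros f E : DworkR p 𝔽)
          - (((p : DworkR p 𝔽) ^ a) ^ k - 1) ^ n := by
  classical
  have hp : p.Prime := Fact.out
  have : CharP E p := charP_of_injective_algebraMap (algebraMap 𝔽 E).injective p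
  have ha : ∀ t : 𝔽, t ^ p ^ a = t := fun t => by rw [← hq, FiniteField.pow_card]
  have ha0 : a ≠ 0 := by
    rintro rfl
    have := Fintype.one_lt_card (α := 𝔽)
    rw [hq, pow_zero] at this
    exact lt_irrefl _ this
  have hb0 : a * k ≠ 0 := mul_ne_zero ha0 (by omega)
  rw [← pow_mul] at hE
  have hcast : ((p ^ (a * k) - 1 : ℕ) : DworkR p 𝔽) = ((p : DworkR p 𝔽) ^ a) ^ k - 1 := by
    rw [Nat.cast_sub (Nat.one_le_pow _ _ hp.pos), Nat.cast_pow, Nat.cast_one, pow_mul]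
  -- As `q^k - 1` is prime to p, it is a unit of R, so the formula itself can define the candidate
  -- trace.
  have hunit : IsUnit (((p ^ (a * k) - 1 : ℕ) : DworkR p 𝔽) ^ (n + 1)) := by
    refine (DworkR.isUnit_natCast p 𝔽 fun hdvd => ?_).pow _
    have h1 := (Nat.dvd_sub_iff_right (Nat.one_le_pow _ _ hp.pos) (dvd_pow_self p hb0)).1 hdvd
    exact hp.one_lt.ne' (Nat.dvd_one.1 h1)
  obtain ⟨c, hc⟩ := hunit
  set r : DworkR p 𝔽 := (p ^ (a * k) : ℕ) * Dwork.torusZeros f E - (p ^ (a * k) - 1 : ℕ) ^ n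
    with hr
  have hct : ((p ^ (a * k) - 1 : ℕ) : DworkR p 𝔽) ^ (n + 1) * (↑c⁻¹ * r) = r := by
    rw [← hc, Units.mul_inv_cancel_left]
  refine ⟨↑c⁻¹ * r, DworkR.hasSum_of_dvd fun N => ?_, ?_⟩
  -- Since π^(p-1) = -p, divisibility by π^((p-1)N) is divisibility by p^N.
  · obtain ⟨U₀, hU₀⟩ := Dwork.exists_finset_pi_pow_dvd E ha hb0 hE f hδ ((p - 1) * N)
    refine ⟨U₀, fun U hU => ?_⟩
    have h := hU₀ U hU
    rw [← hr, ← hct, ← mul_sub, ← hc, Units.dvd_mul_left, pow_mul, DworkR.pi_pow, neg_pow] at h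
    exact dvd_of_mul_left_dvd h
  · rw [← hcast, hct, hr, hcast, Nat.cast_pow, pow_mul]
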